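/- Let $N\ge 2$ and write points of $\mathbb{R}^N$ as $x=(x',x_N)\in\mathbb{R}^{N-1}\times\mathbb{R}$. There is a constant $c=c(N)>0$ such that the following holds for all real $b^-<b^+$. Let $\Omega=\{x\in\mathbb{R}^N : b^-<x_N<b^+\}$ and let $\nu$ be its outward unit normal on $\partial\Omega$. Let $\dot W^{1,1}(\Omega)$ be the space of real functions $u\in L^1_{\mathrm{loc}}(\Omega)$ all of whose first order weak partial derivatives belong to $L^1(\Omega)$ (functions equal almost everywhere in $\Omega$ are identified). Let $L^1_{\mathrm{loc}}(\partial\Omega)$ be taken with respect to the $(N-1)$-dimensional Hausdorff measure $\mathcal{H}^{N-1}$, normalised to be Lebesgue measure on $\mathbb{R}^{N-1}$. Then there exists a unique linear operator $$\operatorname{Tr}:\dot W^{1,1}(\Omega)\to L^1_{\mathrm{loc}}(\partial\Omega)$$ with the following three properties (it is also the only linear operator with these properties when $c$ in (2) is replaced by any other constant). (1) $\operatorname{Tr}(u)=u$ on $\partial\Omega$ for all $u\in\dot W^{1,1}(\Omega)\cap C^0(\overline\Omega)$. (2) For every $u\in\dot W^{1,1}(\Omega)$ and every $0<\varepsilon<b^+-b^-$,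 $$\int_{\mathbb{R}^{N-1}}|\operatorname{Tr}(u)(x',b^+)-\operatorname{Tr}(u)(x',b^-)|\,dx'\le\int_\Omega|\partial_N u(x)|\,dx,$$ and, on each of the two faces $x_N=b^+$ and $x_N=b^-$, $$\sup_{|h'|\le\varepsilon}\int_{\mathbb{R}^{N-1}}|\operatorname{Tr}(u)(x'+h',b^\pm)-\operatorname{Tr}(u)(x',b^\pm)|\,dx'\le c\int_{\Omega_\varepsilon}|\nabla u(x)|\,dx,$$ where $\Omega_\varepsilon=\mathbb{R}^{N-1}\times\big((b^-,b^-+\varepsilon)\cup(b^+-\varepsilon,b^+)\big)$. In particular, $$\lim_{\varepsilon\to0^+}\ \sup_{|h'|\le\varepsilon}\int_{\mathbb{R}^{N-1}}|\operatorname{Tr}(u)(x'+h',b^\pm)-\operatorname{Tr}(u)(x',b^\pm)|\,dx'=0.$$ (3) For all $u\in\dot W^{1,1}(\Omega)$, all $\psi\in C^1_c(\mathbb{R}^N)$ and all $i=1,\dots,N$, the function $u\,\partial_i\psi$ is integrable on $\Omega$ and $$\int_\Omega u\,\partial_i\psi\,dx=-\int_\Omega\psi\,\partial_i u\,dx+\int_{\partial\Omega}\psi\operatorname{Tr}(u)\,\nu_i\,d\mathcal{H}^{N-1}.$$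 -/

import Mathlib

open MeasureTheory Set Filter Topology
open scoped ENNReal ContDiff

noncomputable section

/-- The `i`-th classical partial derivative of `φ : ℝ^d → ℝ`. -/
def partialDeriv {d : ℕ} (i : Fin d) (φ : EuclideanSpace ℝ (Fin d) → ℝ)
    (x : EuclideanSpace ℝ (Fin d)) : ℝ :=
  fderiv ℝ φ x (EuclideanSpace.single i 1)

/-- `g` is an `i`-th weak (distributional) partial derivative of `u` in `Ω`, tested against
`φ ∈ C_c^∞(Ω)`. It is used below only for `u` and `g` locally integrable in `Ω`. -/
def HasWeakPartial {d : ℕ} (Ω : Set (EuclideanSpace ℝ (Fin d))) (i : Fin d)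
    (u g : EuclideanSpace ℝ (Fin d) → ℝ) : Prop :=
  ∀ φ : EuclideanSpace ℝ (Fin d) → ℝ, ContDiff ℝ ∞ φ → HasCompactSupport φ → tsupport φ ⊆ Ω →
    ∫ x in Ω, u x * partialDeriv i φ x = - ∫ x in Ω, g x * φ x

theorem integrableOn_mul_of_compact {d : ℕ} {Ω : Set (EuclideanSpace ℝ (Fin d))}
    {u φ : EuclideanSpace ℝ (Fin d) → ℝ} (hu : LocallyIntegrableOn u Ω)
    (hφ : Continuous φ) (hc : HasCompactSupport φ) (hs : tsupport φ ⊆ Ω) :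
    IntegrableOn (fun x => u x * φ x) Ω := by
  have h1 : IntegrableOn u (tsupport φ) := hu.integrableOn_compact_subset hs hc
  have h2 : IntegrableOn (fun x => u x * φ x) (tsupport φ) :=
    h1.mul_continuousOn hφ.continuousOn hc
  refine (IntegrableOn.integrable_of_forall_notMem_eq_zero h2 fun x hx => ?_).integrableOn
  simp [image_eq_zero_of_notMem_tsupport hx]

theorem continuous_partialDeriv {d : ℕ} (i : Fin d) {φ : EuclideanSpace ℝ (Fin d) → ℝ}
    (hφ : ContDiff ℝ ∞ φ) : Continuous (partialDeriv i φ) :=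
  (hφ.continuous_fderiv (by simp)).clm_apply continuous_const

theorem tsupport_partialDeriv_subset {d : ℕ} (i : Fin d) (φ : EuclideanSpace ℝ (Fin d) → ℝ) :
    tsupport (partialDeriv i φ) ⊆ tsupport φ :=
  tsupport_fderiv_apply_subset ℝ _

theorem integrableOn_mul_partialDeriv {d : ℕ} {Ω : Set (EuclideanSpace ℝ (Fin d))}
    {u φ : EuclideanSpace ℝ (Fin d) → ℝ} (i : Fin d) (hu : LocallyIntegrableOn u Ω)
    (hφ : ContDiff ℝ ∞ φ) (hc : HasCompactSupport φ) (hs : tsupport φ ⊆ Ω) :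
    IntegrableOn (fun x => u x * partialDeriv i φ x) Ω :=
  integrableOn_mul_of_compact hu (continuous_partialDeriv i hφ)
    (hc.mono' ((subset_tsupport _).trans (tsupport_partialDeriv_subset i φ)))
    ((tsupport_partialDeriv_subset i φ).trans hs)

/-- The homogeneous Sobolev space `Ẇ^{1,1}(Ω)`: real functions `u ∈ L¹_loc(Ω)`, up to equality
almost everywhere in `Ω`, whose first order weak partial derivatives all belong to `L¹(Ω)`. -/
def HomSobolev {d : ℕ} (Ω : Set (EuclideanSpace ℝ (Fin d))) :
    Submodule ℝ (EuclideanSpace ℝ (Fin d) →ₘ[volume.restrict Ω] ℝ) where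
  carrier := {u | LocallyIntegrableOn u Ω ∧
    ∀ i : Fin d, ∃ g : EuclideanSpace ℝ (Fin d) → ℝ, IntegrableOn g Ω ∧ HasWeakPartial Ω i u g}
  add_mem' := by
    rintro u v ⟨hu, hu'⟩ ⟨hv, hv'⟩
    refine ⟨(hu.add hv).congr (AEEqFun.coeFn_add u v).symm, fun i => ?_⟩
    obtain ⟨g, hg, hgu⟩ := hu' i
    obtain ⟨k, hk, hkv⟩ := hv' i
    refine ⟨g + k, hg.add hk, fun φ h1 h2 h3 => ?_⟩
    have e : ∫ x in Ω, (u + v : _ →ₘ[volume.restrict Ω] ℝ) x * partialDeriv i φ x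
        = ∫ x in Ω, (u x * partialDeriv i φ x + v x * partialDeriv i φ x) := by
      refine integral_congr_ae ?_
      filter_upwards [AEEqFun.coeFn_add u v] with x hx
      rw [hx, Pi.add_apply, add_mul]
    have e2 : ∫ x in Ω, (g + k) x * φ x = ∫ x in Ω, (g x * φ x + k x * φ x) := by
      simp only [Pi.add_apply, add_mul]
    rw [e, e2, integral_add (integrableOn_mul_partialDeriv i hu h1 h2 h3)
      (integrableOn_mul_partialDeriv i hv h1 h2 h3),
      integral_add (integrableOn_mul_of_compact hg.locallyIntegrableOn h1.continuous h2 h3)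
      (integrableOn_mul_of_compact hk.locallyIntegrableOn h1.continuous h2 h3),
      hgu φ h1 h2 h3, hkv φ h1 h2 h3, neg_add]
  zero_mem' := by
    have h0 : (0 : EuclideanSpace ℝ (Fin d) → ℝ) =ᵐ[volume.restrict Ω]
      (0 : EuclideanSpace ℝ (Fin d) →ₘ[volume.restrict Ω] ℝ) := AEEqFun.coeFn_zero.symm
    refine ⟨LocallyIntegrableOn.congr h0 locallyIntegrableOn_zero, fun i =>
      ⟨0, integrableOn_zero, fun φ h1 h2 h3 => ?_⟩⟩
    have e : ∫ x in Ω, (0 : EuclideanSpace ℝ (Fin d) →ₘ[volume.restrict Ω] ℝ) x *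
        partialDeriv i φ x = ∫ x in Ω, (0 : ℝ) := by
      refine integral_congr_ae ?_
      filter_upwards [h0] with x hx
      rw [← hx, Pi.zero_apply, zero_mul]
    rw [e]
    simp
  smul_mem' := by
    rintro c u ⟨hu, hu'⟩
    refine ⟨(hu.smul c).congr (AEEqFun.coeFn_smul c u).symm, fun i => ?_⟩
    obtain ⟨g, hg, hgu⟩ := hu' i
    refine ⟨c • g, hg.smul c, fun φ h1 h2 h3 => ?_⟩
    have e : ∫ x in Ω, (c • u : _ →ₘ[volume.restrict Ω] ℝ) x * partialDeriv i φ x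
        = ∫ x in Ω, c * (u x * partialDeriv i φ x) := by
      refine integral_congr_ae ?_
      filter_upwards [AEEqFun.coeFn_smul c u] with x hx
      rw [hx, Pi.smul_apply, smul_eq_mul, mul_assoc]
    have e2 : ∫ x in Ω, (c • g) x * φ x = ∫ x in Ω, c * (g x * φ x) := by
      simp only [Pi.smul_apply, smul_eq_mul, mul_assoc]
    rw [e, e2, integral_const_mul, integral_const_mul, hgu φ h1 h2 h3, mul_neg]

/-- The weak partial derivative `∂ᵢ u ∈ L¹(Ω)` of `u ∈ Ẇ^{1,1}(Ω)` (for `Ω` open it is unique up to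
equality almost everywhere in `Ω`). -/
def weakPartial {d : ℕ} {Ω : Set (EuclideanSpace ℝ (Fin d))} (u : HomSobolev Ω) (i : Fin d) :
    EuclideanSpace ℝ (Fin d) → ℝ :=
  (u.2.2 i).choose

theorem integrableOn_weakPartial {d : ℕ} {Ω : Set (EuclideanSpace ℝ (Fin d))} (u : HomSobolev Ω)
    (i : Fin d) : IntegrableOn (weakPartial u i) Ω :=
  (u.2.2 i).choose_spec.1

theorem hasWeakPartial_weakPartial {d : ℕ} {Ω : Set (EuclideanSpace ℝ (Fin d))}
    (u : HomSobolev Ω) (i : Fin d) :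
    HasWeakPartial Ω i (u : EuclideanSpace ℝ (Fin d) →ₘ[volume.restrict Ω] ℝ) (weakPartial u i) :=
  (u.2.2 i).choose_spec.2

/-- The weak gradient `∇u` of `u ∈ Ẇ^{1,1}(Ω)`; its pointwise norm is the Euclidean one. -/
def weakGradient {d : ℕ} {Ω : Set (EuclideanSpace ℝ (Fin d))} (u : HomSobolev Ω)
    (x : EuclideanSpace ℝ (Fin d)) : EuclideanSpace ℝ (Fin d) :=
  WithLp.toLp 2 fun i => weakPartial u i x

/-- The point `(x', t) ∈ ℝ^n × ℝ = ℝ^{n+1}`, whose last coordinate is `t`. -/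
def withLast {n : ℕ} (x' : EuclideanSpace ℝ (Fin n)) (t : ℝ) : EuclideanSpace ℝ (Fin (n + 1)) :=
  WithLp.toLp 2 (Fin.snoc (α := fun _ => ℝ) x' t)

/-- The flat strip `ℝ^n × (b⁻, b⁺)` in `ℝ^{n+1}`. -/
def strip (n : ℕ) (bm bp : ℝ) : Set (EuclideanSpace ℝ (Fin (n + 1))) :=
  {x | bm < x (Fin.last n) ∧ x (Fin.last n) < bp}

/-- The set `ℝ^n × ((b⁻, b⁻ + ε) ∪ (b⁺ - ε, b⁺))`. -/
def stripCollar (n : ℕ) (bm bp ε : ℝ) : Set (EuclideanSpace ℝ (Fin (n + 1))) :=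
  {x | x (Fin.last n) ∈ Ioo bm (bm + ε) ∪ Ioo (bp - ε) bp}

/-- The `n`-dimensional Hausdorff measure (normalised to be Lebesgue measure on `ℝ^n`) on the
topological boundary of `Ω ⊆ ℝ^{n+1}`. -/
def surfaceMeasure {n : ℕ} (Ω : Set (EuclideanSpace ℝ (Fin (n + 1)))) :
    Measure (EuclideanSpace ℝ (Fin (n + 1))) :=
  (Measure.euclideanHausdorffMeasure n).restrict (frontier Ω)

/-- The space `L¹_loc(∂Ω)`: classes, up to almost everywhere equality for the surface measure, of
functions that are locally integrable for the surface measure. -/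
def LocL1Boundary {n : ℕ} (Ω : Set (EuclideanSpace ℝ (Fin (n + 1)))) :
    Submodule ℝ (EuclideanSpace ℝ (Fin (n + 1)) →ₘ[surfaceMeasure Ω] ℝ) where
  carrier := {f | LocallyIntegrable f (surfaceMeasure Ω)}
  add_mem' := fun {f g} hf hg =>
    LocallyIntegrable.congr (LocallyIntegrable.add hf hg) (AEEqFun.coeFn_add f g).symm
  zero_mem' := LocallyIntegrable.congr locallyIntegrable_zero AEEqFun.coeFn_zero.symm
  smul_mem' := fun c f hf =>
    LocallyIntegrable.congr (LocallyIntegrable.smul hf c) (AEEqFun.coeFn_smul c f).symm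

/-- A representative `ℝ^{n+1} → ℝ` (meaningful almost everywhere on `∂Ω`) of `f ∈ L¹_loc(∂Ω)`. -/
def boundaryRep {n : ℕ} {Ω : Set (EuclideanSpace ℝ (Fin (n + 1)))} (f : LocL1Boundary Ω) :
    EuclideanSpace ℝ (Fin (n + 1)) → ℝ :=
  (f : EuclideanSpace ℝ (Fin (n + 1)) →ₘ[surfaceMeasure Ω] ℝ)

/-- A representative (meaningful almost everywhere in `Ω`) of `u ∈ Ẇ^{1,1}(Ω)`. -/
def sobolevRep {d : ℕ} {Ω : Set (EuclideanSpace ℝ (Fin d))} (u : HomSobolev Ω) :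
    EuclideanSpace ℝ (Fin d) → ℝ :=
  (u : EuclideanSpace ℝ (Fin d) →ₘ[volume.restrict Ω] ℝ)

/-- The `i`-th component of the outward unit normal of the strip, at a point of its boundary:
the normal is `e_{n+1}` on the top face `x_{n+1} = b⁺` and `-e_{n+1}` on the bottom face. -/
def stripNormal {n : ℕ} (bp : ℝ) (i : Fin (n + 1)) (x : EuclideanSpace ℝ (Fin (n + 1))) : ℝ :=
  if i = Fin.last n then (if x (Fin.last n) = bp then 1 else -1) else 0

/-- The `L¹(ℝ^n)` modulus of continuity
`sup_{|h'| ≤ ε} ∫ |f(x' + h', b) - f(x', b)| dx'` of `f` on the hyperplane `x_{n+1} = b`. -/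
def faceModulus {n : ℕ} (f : EuclideanSpace ℝ (Fin (n + 1)) → ℝ) (b ε : ℝ) : ℝ≥0∞ :=
  ⨆ h : EuclideanSpace ℝ (Fin n), ⨆ _ : ‖h‖ ≤ ε,
    ∫⁻ x' : EuclideanSpace ℝ (Fin n), ‖f (withLast (x' + h) b) - f (withLast x' b)‖ₑ

/-- The defining properties of the trace on the strip, with constant `c`. -/
structure IsStripTrace (n : ℕ) (bm bp c : ℝ)
    (Tr : HomSobolev (strip n bm bp) →ₗ[ℝ] LocL1Boundary (strip n bm bp)) : Prop where
  /-- `Tr u = u` on `∂Ω` if `u` has a representative `v` that is continuous up to the boundary. -/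
  eq_of_continuous : ∀ (u : HomSobolev (strip n bm bp)) (v : EuclideanSpace ℝ (Fin (n + 1)) → ℝ),
    ContinuousOn v (closure (strip n bm bp)) → sobolevRep u =ᵐ[volume.restrict (strip n bm bp)] v →
    boundaryRep (Tr u) =ᵐ[surfaceMeasure (strip n bm bp)] v
  /-- The `L¹` estimate of the jump between the two faces. -/
  jump_le : ∀ u : HomSobolev (strip n bm bp),
    ∫⁻ x' : EuclideanSpace ℝ (Fin n),
        ‖boundaryRep (Tr u) (withLast x' bp) - boundaryRep (Tr u) (withLast x' bm)‖ₑ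
      ≤ ∫⁻ x in strip n bm bp, ‖weakPartial u (Fin.last n) x‖ₑ
  /-- The estimate of the modulus of continuity on each of the two faces. -/
  modulus_le : ∀ (u : HomSobolev (strip n bm bp)) (ε : ℝ), 0 < ε → ε < bp - bm →
    ∀ b ∈ ({bm, bp} : Set ℝ), faceModulus (boundaryRep (Tr u)) b ε
      ≤ ENNReal.ofReal c * ∫⁻ x in stripCollar n bm bp ε, ‖weakGradient u x‖ₑ
  /-- The modulus of continuity on each of the two faces tends to `0`. -/
  modulus_tendsto : ∀ u : HomSobolev (strip n bm bp), ∀ b ∈ ({bm, bp} : Set ℝ),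
    Tendsto (fun ε => faceModulus (boundaryRep (Tr u)) b ε) (𝓝[>] 0) (𝓝 0)
  /-- The integral over `Ω` on the left of the integration by parts formula converges. -/
  integrableOn_mul : ∀ (u : HomSobolev (strip n bm bp)) (ψ : EuclideanSpace ℝ (Fin (n + 1)) → ℝ),
    ContDiff ℝ 1 ψ → HasCompactSupport ψ → ∀ i : Fin (n + 1),
    IntegrableOn (fun x => sobolevRep u x * partialDeriv i ψ x) (strip n bm bp)
  /-- Integration by parts. -/
  integral_by_parts : ∀ (u : HomSobolev (strip n bm bp)) (ψ : EuclideanSpace ℝ (Fin (n + 1)) → ℝ),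
    ContDiff ℝ 1 ψ → HasCompactSupport ψ → ∀ i : Fin (n + 1),
    ∫ x in strip n bm bp, sobolevRep u x * partialDeriv i ψ x
      = - (∫ x in strip n bm bp, ψ x * weakPartial u i x)
        + ∫ x, ψ x * boundaryRep (Tr u) x * stripNormal bp i x ∂(surfaceMeasure (strip n bm bp))

end

/-! Since the last weak derivative is integrable, `u` is absolutely continuous on almost every
vertical segment: `u(x', t) = f(x') + ∫ s in bm..t, ∂_N u(x', s)` for a.e. `(x', t)` in the strip
(`exists_vertical_representation`). The right side makes sense for every `t`, so its values at `bm`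
and `bp` are taken as the trace (`traceAt`). The source of everything is a fundamental theorem of
calculus along segments in the domain (`ae_sub_eq_integral_inner`), got by moving translations onto
test functions and using Fubini.

The jump estimate is then immediate, and for `u` continuous up to the boundary both sides are
continuous on almost every closed vertical segment, hence agree at the endpoints. For the modulus of
continuity, go from `(x', b)` vertically to height `t`, horizontally by `h'`, and back to height
`b`; average over `t` in a slab of width `ε ≥ |h'|`. Each of the two vertical pieces costs at most
the integral of `|∇u|` over the slab, and the horizontal one costs `|h'| / ε` times it, whence `c =
3` (`lintegral_traceAt_translate_le`).

Integration by parts is one-dimensional in the vertical direction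
(`integral_mul_partialDeriv_last`). In horizontal directions it follows from the translation
invariance of the strip (`integral_mul_fderiv_horizontal`).

For uniqueness, integration by parts with `i = N` determines `Tr u` times the last component of the
normal, which is `±1` on the faces (`LocL1Boundary.ext_of_integral_eq`). The same fact makes the
constructed trace linear, and no constant enters it. -/

noncomputable section

/-! ### Coordinates `(x', t)` and product measure -/

@[simp] theorem withLast_last {n : ℕ} (x' : EuclideanSpace ℝ (Fin n)) (t : ℝ) :
    withLast x' t (Fin.last n) = t := by
  simp [withLast]

@[simp] theorem withLast_castSucc {n : ℕ} (x' : EuclideanSpace ℝ (Fin n)) (t : ℝ) (i : Fin n) :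
    withLast x' t i.castSucc = x' i := by
  simp [withLast]

/-- The linear homeomorphism `(x', t) ↦ withLast x' t`. -/
def withLastL (n : ℕ) :
    (EuclideanSpace ℝ (Fin n) × ℝ) ≃L[ℝ] EuclideanSpace ℝ (Fin (n + 1)) :=
  LinearEquiv.toContinuousLinearEquiv
    { toFun := fun p => withLast p.1 p.2
      invFun := fun x => (WithLp.toLp 2 fun i : Fin n => x i.castSucc, x (Fin.last n))
      map_add' := fun p q => by
        ext i
        refine Fin.lastCases ?_ (fun j => ?_) i <;> simp
      map_smul' := fun c p => by
        ext i
        refine Fin.lastCases ?_ (fun j => ?_) i <;> simp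
      left_inv := fun p => by
        refine Prod.ext ?_ (by simp)
        ext i
        simp
      right_inv := fun x => by
        ext i
        refine Fin.lastCases ?_ (fun j => ?_) i <;> simp }

@[simp] theorem withLastL_apply {n : ℕ} (p : EuclideanSpace ℝ (Fin n) × ℝ) :
    withLastL n p = withLast p.1 p.2 := rfl

theorem withLast_symm {n : ℕ} (x : EuclideanSpace ℝ (Fin (n + 1))) :
    withLast ((withLastL n).symm x).1 (x (Fin.last n)) = x :=
  (withLastL n).apply_symm_apply x

theorem withLast_add {n : ℕ} (x y : EuclideanSpace ℝ (Fin n)) (s t : ℝ) :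
    withLast (x + y) (s + t) = withLast x s + withLast y t :=
  (withLastL n).map_add (x, s) (y, t)

theorem withLast_smul {n : ℕ} (c : ℝ) (x : EuclideanSpace ℝ (Fin n)) (s : ℝ) :
    withLast (c • x) (c * s) = c • withLast x s :=
  (withLastL n).map_smul c (x, s)

theorem norm_withLast_zero {n : ℕ} (x : EuclideanSpace ℝ (Fin n)) :
    ‖withLast x 0‖ = ‖x‖ := by
  simp [EuclideanSpace.norm_eq, Fin.sum_univ_castSucc]

theorem withLast_zero_one (n : ℕ) :
    withLast (0 : EuclideanSpace ℝ (Fin n)) 1 = EuclideanSpace.single (Fin.last n) 1 := by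
  ext i
  refine Fin.lastCases ?_ (fun j => ?_) i
  · simp
  · simp [(Fin.castSucc_lt_last j).ne]

theorem withLast_single_zero {n : ℕ} (j : Fin n) :
    withLast (EuclideanSpace.single j (1 : ℝ)) 0 = EuclideanSpace.single j.castSucc 1 := by
  ext i
  refine Fin.lastCases ?_ (fun k => ?_) i
  · simp [(Fin.castSucc_lt_last j).ne']
  · simp

@[fun_prop] theorem continuous_withLast {n : ℕ} :
    Continuous (fun p : EuclideanSpace ℝ (Fin n) × ℝ => withLast p.1 p.2) :=
  (withLastL n).continuous

/-- The coordinate `Fin.last n` is split off the product measure with the two factors swapped; both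
`WithLp` identifications preserve volume. -/
theorem measurePreserving_withLast (n : ℕ) :
    MeasurePreserving (fun p : EuclideanSpace ℝ (Fin n) × ℝ => withLast p.1 p.2) := by
  have h1 := (volume_preserving_piFinSuccAbove (fun _ : Fin (n + 1) => ℝ) (Fin.last n)).symm
  have h2 : MeasurePreserving (Prod.swap : EuclideanSpace ℝ (Fin n) × ℝ → _) :=
    Measure.measurePreserving_swap
  have h3 : MeasurePreserving (Prod.map id WithLp.ofLp : ℝ × EuclideanSpace ℝ (Fin n) → _)
      (volume.prod volume) (volume.prod volume) :=
    (MeasurePreserving.id volume).prod (PiLp.volume_preserving_ofLp (Fin n))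
  have h := (PiLp.volume_preserving_toLp (Fin (n + 1))).comp (h1.comp (h3.comp h2))
  convert! h using 1
  funext p
  exact congrArg (WithLp.toLp 2) (Fin.insertNth_last' p.2 p.1.ofLp).symm

/-- The measurable equivalence `(x', t) ↦ withLast x' t`. -/
def withLastM (n : ℕ) :
    (EuclideanSpace ℝ (Fin n) × ℝ) ≃ᵐ EuclideanSpace ℝ (Fin (n + 1)) :=
  (withLastL n).toHomeomorph.toMeasurableEquiv

theorem measurableEmbedding_withLast (n : ℕ) :
    MeasurableEmbedding (fun p : EuclideanSpace ℝ (Fin n) × ℝ => withLast p.1 p.2) :=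
  (withLastM n).measurableEmbedding

theorem preimage_withLast_setOf {n : ℕ} (J : Set ℝ) :
    (fun p : EuclideanSpace ℝ (Fin n) × ℝ => withLast p.1 p.2) ⁻¹' {x | x (Fin.last n) ∈ J}
      = univ ×ˢ J := by
  ext p; simp

/-- Restricting to a slab `ℝⁿ × J` corresponds to restricting the last variable. -/
theorem measurePreserving_withLast_restrict {n : ℕ} {J : Set ℝ} (hJ : MeasurableSet J) :
    MeasurePreserving (fun p : EuclideanSpace ℝ (Fin n) × ℝ => withLast p.1 p.2)
      ((volume : Measure (EuclideanSpace ℝ (Fin n))).prod (volume.restrict J))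
      (volume.restrict {x | x (Fin.last n) ∈ J}) := by
  have hm : MeasurableSet {x : EuclideanSpace ℝ (Fin (n + 1)) | x (Fin.last n) ∈ J} :=
    measurableSet_preimage (by fun_prop) hJ
  have h := (measurePreserving_withLast n).restrict_preimage hm
  rw [preimage_withLast_setOf, Measure.volume_eq_prod, ← Measure.prod_restrict,
    Measure.restrict_univ] at h
  exact h

/-! ### Topology of the strip and its surface measure -/

theorem strip_eq (n : ℕ) (bm bp : ℝ) : strip n bm bp = {x | x (Fin.last n) ∈ Ioo bm bp} := rfl

theorem isOpen_strip (n : ℕ) (bm bp : ℝ) : IsOpen (strip n bm bp) :=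
  isOpen_Ioo.preimage (by fun_prop : Continuous fun x : EuclideanSpace ℝ (Fin (n + 1)) =>
    x (Fin.last n))

theorem isOpenMap_last (n : ℕ) :
    IsOpenMap (fun x : EuclideanSpace ℝ (Fin (n + 1)) => x (Fin.last n)) :=
  isOpenMap_snd.comp (withLastL n).symm.toHomeomorph.isOpenMap

/-- The last coordinate is a continuous open map, so taking preimages commutes with closure. -/
theorem closure_strip {n : ℕ} {bm bp : ℝ} (h : bm < bp) :
    closure (strip n bm bp) = {x | x (Fin.last n) ∈ Icc bm bp} := by
  rw [← closure_Ioo h.ne]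
  exact ((isOpenMap_last n).preimage_closure_eq_closure_preimage (by fun_prop)
    (Ioo bm bp)).symm

theorem frontier_strip {n : ℕ} {bm bp : ℝ} (h : bm < bp) :
    frontier (strip n bm bp) = {x | x (Fin.last n) = bm} ∪ {x | x (Fin.last n) = bp} := by
  rw [frontier, closure_strip h, (isOpen_strip n bm bp).interior_eq]
  ext x
  simp only [strip, Set.mem_sdiff, mem_ofPred_eq, mem_Icc, mem_union]
  constructor
  · rintro ⟨⟨h1, h2⟩, h3⟩
    rcases h1.eq_or_lt with h4 | h4
    · exact Or.inl h4.symm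
    · exact Or.inr (le_antisymm h2 (not_lt.1 fun h5 => h3 ⟨h4, h5⟩))
  · rintro (h1 | h1) <;> simp [h1, h.le]

theorem isometry_withLast {n : ℕ} (b : ℝ) :
    Isometry (fun x' : EuclideanSpace ℝ (Fin n) => withLast x' b) := by
  refine Isometry.of_dist_eq fun x y => ?_
  have h : withLast x b - withLast y b = withLast (x - y) 0 := by
    rw [sub_eq_iff_eq_add, ← withLast_add]; simp
  rw [dist_eq_norm, dist_eq_norm, h, norm_withLast_zero]

theorem range_withLast {n : ℕ} (b : ℝ) :
    range (fun x' : EuclideanSpace ℝ (Fin n) => withLast x' b) = {x | x (Fin.last n) = b} := by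
  ext x
  constructor
  · rintro ⟨y, rfl⟩; simp
  · rintro rfl; exact ⟨_, withLast_symm x⟩

/-- The surface measure of the strip is Lebesgue measure on each of the two faces. -/
theorem surfaceMeasure_strip {n : ℕ} {bm bp : ℝ} (h : bm < bp) :
    surfaceMeasure (strip n bm bp)
      = (volume : Measure (EuclideanSpace ℝ (Fin n))).map (fun x' => withLast x' bm)
        + (volume : Measure (EuclideanSpace ℝ (Fin n))).map (fun x' => withLast x' bp) := by
  have hf : ∀ b : ℝ, (volume : Measure (EuclideanSpace ℝ (Fin n))).map (fun x' => withLast x' b)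
      = (Measure.euclideanHausdorffMeasure n).restrict
        {x : EuclideanSpace ℝ (Fin (n + 1)) | x (Fin.last n) = b} := fun b => by
    -- The normalised Hausdorff measure is volume on `ℝⁿ`, and the isometry `x' ↦ (x', b)` carries
    -- it to its restriction to the face.
    rw [← EuclideanSpace.euclideanHausdorffMeasure_eq_volume,
      (isometry_withLast b).map_euclideanHausdorffMeasure, range_withLast]
  rw [surfaceMeasure, frontier_strip h, Measure.restrict_union, hf, hf]
  · rw [disjoint_left]
    rintro x rfl h2
    exact h.ne h2
  · exact measurableSet_eq_fun (by fun_prop) (by fun_prop)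

theorem measurableEmbedding_withLast_left {n : ℕ} (b : ℝ) :
    MeasurableEmbedding (fun x' : EuclideanSpace ℝ (Fin n) => withLast x' b) :=
  (isometry_withLast b).isClosedEmbedding.measurableEmbedding

theorem ae_surfaceMeasure_strip_iff {n : ℕ} {bm bp : ℝ} (h : bm < bp)
    {p : EuclideanSpace ℝ (Fin (n + 1)) → Prop} :
    (∀ᵐ x ∂surfaceMeasure (strip n bm bp), p x) ↔
      (∀ᵐ x' : EuclideanSpace ℝ (Fin n), p (withLast x' bm)) ∧
        ∀ᵐ x' : EuclideanSpace ℝ (Fin n), p (withLast x' bp) := by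
  rw [surfaceMeasure_strip h, ae_add_measure_iff,
    (measurableEmbedding_withLast_left bm).ae_map_iff,
    (measurableEmbedding_withLast_left bp).ae_map_iff]

theorem integral_surfaceMeasure_strip {n : ℕ} {bm bp : ℝ} (h : bm < bp)
    {f : EuclideanSpace ℝ (Fin (n + 1)) → ℝ}
    (hf : Integrable f (surfaceMeasure (strip n bm bp))) :
    ∫ x, f x ∂surfaceMeasure (strip n bm bp) =
      (∫ x' : EuclideanSpace ℝ (Fin n), f (withLast x' bm))
        + ∫ x' : EuclideanSpace ℝ (Fin n), f (withLast x' bp) := by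
  rw [surfaceMeasure_strip h] at hf ⊢
  rw [integral_add_measure (integrable_add_measure.1 hf).1 (integrable_add_measure.1 hf).2,
    (measurableEmbedding_withLast_left bm).integral_map,
    (measurableEmbedding_withLast_left bp).integral_map]

theorem locallyIntegrable_surfaceMeasure_strip {n : ℕ} {bm bp : ℝ} (h : bm < bp)
    {f : EuclideanSpace ℝ (Fin (n + 1)) → ℝ}
    (h1 : LocallyIntegrable (fun x' : EuclideanSpace ℝ (Fin n) => f (withLast x' bm)))
    (h2 : LocallyIntegrable (fun x' : EuclideanSpace ℝ (Fin n) => f (withLast x' bp))) :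
    LocallyIntegrable f (surfaceMeasure (strip n bm bp)) := by
  have key : ∀ b : ℝ, LocallyIntegrable (fun x' : EuclideanSpace ℝ (Fin n) => f (withLast x' b)) →
      ∀ K : Set (EuclideanSpace ℝ (Fin (n + 1))), IsCompact K →
      IntegrableOn f K ((volume : Measure (EuclideanSpace ℝ (Fin n))).map
        (fun x' => withLast x' b)) := by
    intro b hb K hK
    rw [(measurableEmbedding_withLast_left b).integrableOn_map_iff]
    exact hb.integrableOn_isCompact ((isometry_withLast b).isClosedEmbedding.isCompact_preimage hK)
  rw [locallyIntegrable_iff]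
  intro K hK
  rw [surfaceMeasure_strip h, IntegrableOn, Measure.restrict_add, integrable_add_measure]
  exact ⟨key bm h1 K hK, key bp h2 K hK⟩

/-! ### Fundamental theorem of calculus along segments -/

theorem fderiv_apply_eq_sum_partialDeriv {d : ℕ} (φ : EuclideanSpace ℝ (Fin d) → ℝ)
    (x h : EuclideanSpace ℝ (Fin d)) :
    fderiv ℝ φ x h = ∑ i, h i * partialDeriv i φ x := by
  have hh : h = ∑ i, h i • EuclideanSpace.single i (1 : ℝ) := by
    ext j
    simp [Pi.single_apply]
  conv_lhs => rw [hh]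
  simp [partialDeriv]

/-- Integration by parts for the weak derivative in a direction `h`. -/
theorem integral_mul_fderiv_eq {d : ℕ} {Ω : Set (EuclideanSpace ℝ (Fin d))}
    {u : EuclideanSpace ℝ (Fin d) → ℝ} {V : EuclideanSpace ℝ (Fin d) → EuclideanSpace ℝ (Fin d)}
    (hu : LocallyIntegrableOn u Ω) (hV : Integrable V)
    (hw : ∀ i, HasWeakPartial Ω i u fun x => V x i) (h : EuclideanSpace ℝ (Fin d))
    {φ : EuclideanSpace ℝ (Fin d) → ℝ} (hφ : ContDiff ℝ ∞ φ) (hc : HasCompactSupport φ)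
    (hs : tsupport φ ⊆ Ω) :
    ∫ x in Ω, u x * fderiv ℝ φ x h = - ∫ x in Ω, inner ℝ (V x) h * φ x := by
  have hVi : ∀ i, Integrable fun x => V x i := fun i =>
    (EuclideanSpace.proj i : EuclideanSpace ℝ (Fin d) →L[ℝ] ℝ).integrable_comp hV
  have e1 : ∀ x, u x * fderiv ℝ φ x h = ∑ i, h i * (u x * partialDeriv i φ x) := fun x => by
    rw [fderiv_apply_eq_sum_partialDeriv, Finset.mul_sum]
    exact Finset.sum_congr rfl fun i _ => by ring
  have e2 : ∀ x, inner ℝ (V x) h * φ x = ∑ i, h i * (V x i * φ x) := fun x => by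
    rw [PiLp.inner_apply, Finset.sum_mul]
    exact Finset.sum_congr rfl fun i _ => by simp; ring
  simp_rw [e1, e2]
  rw [integral_finsetSum _ fun i _ => (integrableOn_mul_partialDeriv i hu hφ hc hs).const_mul _,
    integral_finsetSum _ fun i _ => (integrableOn_mul_of_compact
      (hVi i).integrableOn.locallyIntegrableOn hφ.continuous hc hs).const_mul _,
    ← Finset.sum_neg_distrib]
  refine Finset.sum_congr rfl fun i _ => ?_
  rw [integral_const_mul, integral_const_mul, hw i φ hφ hc hs, mul_neg]

/-- By Fubini with `s` outermost: each slice is a translate of `G`, so its `L¹` norm is constant in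
`s`, and `ν` is finite. -/
theorem integrable_comp_add_smul {E : Type*} [NormedAddCommGroup E] [NormedSpace ℝ E]
    [MeasurableSpace E] [BorelSpace E] [SecondCountableTopology E] {μ : Measure E} [SFinite μ]
    [μ.IsAddRightInvariant] {G : E → ℝ} (hGm : StronglyMeasurable G) (hG : Integrable G μ) (h : E)
    (ν : Measure ℝ) [IsFiniteMeasure ν] :
    Integrable (fun p : E × ℝ => G (p.1 + p.2 • h)) (μ.prod ν) := by
  have hm : AEStronglyMeasurable (fun p : E × ℝ => G (p.1 + p.2 • h)) (μ.prod ν) :=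
    (hGm.comp_measurable (by fun_prop)).aestronglyMeasurable
  rw [integrable_prod_iff' hm]
  refine ⟨Eventually.of_forall fun s => hG.comp_add_right (s • h), ?_⟩
  simp_rw [fun s : ℝ => integral_add_right_eq_self (μ := μ) (fun x => ‖G x‖) (s • h)]
  exact integrable_const _

/-- Fundamental theorem of calculus along a segment, for weakly differentiable functions. -/
theorem ae_sub_eq_integral_inner {d : ℕ} {Ω U : Set (EuclideanSpace ℝ (Fin d))}
    {u : EuclideanSpace ℝ (Fin d) → ℝ} {V : EuclideanSpace ℝ (Fin d) → EuclideanSpace ℝ (Fin d)}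
    (hu : LocallyIntegrableOn u Ω) (hVm : StronglyMeasurable V) (hV : Integrable V)
    (hV0 : ∀ x ∉ Ω, V x = 0)
    (hw : ∀ i, HasWeakPartial Ω i u fun x => V x i) (hU : IsOpen U)
    (h : EuclideanSpace ℝ (Fin d)) (hUΩ : ∀ x ∈ U, ∀ s ∈ Icc (0 : ℝ) 1, x + s • h ∈ Ω) :
    ∀ᵐ x, x ∈ U → u (x + h) - u x = ∫ s in Icc (0 : ℝ) 1, inner ℝ (V (x + s • h)) h := by
  set G : EuclideanSpace ℝ (Fin d) → ℝ := fun x => inner ℝ (V x) h with hGdef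
  have hGm : StronglyMeasurable G := hVm.inner stronglyMeasurable_const
  have hG : Integrable G := hV.inner_const h
  have hG0 : ∀ x ∉ Ω, G x = 0 := fun x hx => by simp [hGdef, hV0 x hx]
  have hGp := integrable_comp_add_smul hGm hG h (volume.restrict (Icc (0 : ℝ) 1))
  have hUsub : U ⊆ Ω := fun x hx => by simpa using hUΩ x hx 0 (by simp)
  have hu1 : LocallyIntegrableOn (fun x => u (x + h)) U := by
    rw [locallyIntegrableOn_iff hU.isLocallyClosed]
    intro K hKU hK
    have h1 : IntegrableOn u ((fun x => x + h) '' K) := by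
      refine hu.integrableOn_compact_subset ?_ (hK.image (by fun_prop))
      rintro _ ⟨x, hx, rfl⟩
      simpa using hUΩ x (hKU hx) 1 (by simp)
    exact ((measurePreserving_add_right volume h).integrableOn_image
      (measurableEmbedding_addRight h)).1 h1
  have hD : LocallyIntegrableOn
      (fun x => u (x + h) - u x - ∫ s in Icc (0 : ℝ) 1, G (x + s • h)) U :=
    (hu1.sub (hu.mono_set hUsub)).sub hGp.integral_prod_left.integrableOn.locallyIntegrableOn
  -- The identity is tested against `φ`. Translations move onto the test functions `φ (x - s • h)`,
  -- whose `s`-derivative is minus the derivative along `h`; this is what the weak derivative sees.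
  have main : ∀ φ : EuclideanSpace ℝ (Fin d) → ℝ, ContDiff ℝ ∞ φ → HasCompactSupport φ →
      tsupport φ ⊆ U →
      ∫ x, φ x • (u (x + h) - u x - ∫ s in Icc (0 : ℝ) 1, G (x + s • h)) = 0 := by
    intro φ hφ hc hs
    -- `K` is swept out by the support of `φ` along the segment. It is compact in `Ω`, so `u` cut
    -- off to `K` is integrable on the whole space and agrees with `u` against every translated test
    -- function.
    set K : Set (EuclideanSpace ℝ (Fin d)) :=
      (fun p : EuclideanSpace ℝ (Fin d) × ℝ => p.1 + p.2 • h) '' (tsupport φ ×ˢ Icc (0 : ℝ) 1)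
      with hKdef
    have hKc : IsCompact K := (IsCompact.prod hc isCompact_Icc).image (by fun_prop)
    have hKΩ : K ⊆ Ω := by
      rintro _ ⟨⟨x, s⟩, ⟨hx, hs'⟩, rfl⟩
      exact hUΩ x (hs hx) s hs'
    have hKmem : ∀ s ∈ Icc (0 : ℝ) 1, ∀ x, x ∉ K → x - s • h ∉ tsupport φ := by
      intro s hs' x hx hx'
      exact hx ⟨(x - s • h, s), ⟨hx', hs'⟩, by simp⟩
    set v := K.indicator u with hv
    have hvi : Integrable v :=
      (integrable_indicator_iff hKc.measurableSet).2 (hu.integrableOn_compact_subset hKΩ hKc)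
    have hvu : ∀ (a : ℝ) x, (x ∉ K → a = 0) → u x * a = v x * a := by
      intro a x ha
      by_cases hx : x ∈ K
      · simp [hv, hx]
      · simp [ha hx]
    obtain ⟨C, hC⟩ := hc.exists_bound_of_continuous hφ.continuous
    have hdc : Continuous fun x => fderiv ℝ φ x h :=
      (hφ.continuous_fderiv (by simp)).clm_apply continuous_const
    have hdcs : HasCompactSupport fun x => fderiv ℝ φ x h := hc.fderiv_apply ℝ h
    obtain ⟨C', hC'⟩ := hdcs.exists_bound_of_continuous hdc
    have hA : ∀ s ∈ Icc (0 : ℝ) 1, ∫ x, G x * φ (x - s • h)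
        = - ∫ x, v x * fderiv ℝ φ (x - s • h) h := by
      intro s hs'
      have hsupp : tsupport (fun x => φ (x - s • h)) ⊆ K := by
        intro x hx
        by_contra hxK
        refine hKmem s hs' x hxK ?_
        have := tsupport_comp_subset_preimage φ (f := fun x => x - s • h) (by fun_prop)
        exact this hx
      have hcs : HasCompactSupport (fun x => φ (x - s • h)) :=
        hKc.of_isClosed_subset (isClosed_tsupport _) hsupp
      have h1 := integral_mul_fderiv_eq hu hV hw h (φ := fun x => φ (x - s • h))
        (hφ.comp (contDiff_id.sub contDiff_const)) hcs (hsupp.trans hKΩ)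
      have h2 : ∀ x, fderiv ℝ (fun x => φ (x - s • h)) x = fderiv ℝ φ (x - s • h) := fun x =>
        fderiv_comp_sub (s • h)
      simp_rw [h2] at h1
      have h3 : ∫ x in Ω, u x * fderiv ℝ φ (x - s • h) h
          = ∫ x, v x * fderiv ℝ φ (x - s • h) h := by
        have h4 : ∀ x, u x * fderiv ℝ φ (x - s • h) h = v x * fderiv ℝ φ (x - s • h) h :=
          fun x => hvu _ x fun hx => by
            rw [image_eq_zero_of_notMem_tsupport (f := fderiv ℝ φ)
              fun hx' => hKmem s hs' x hx (tsupport_fderiv_subset ℝ hx')]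
            rfl
        simp_rw [h4]
        refine setIntegral_eq_integral_of_forall_compl_eq_zero fun x hx => ?_
        rw [hv, indicator_of_notMem fun hx' => hx (hKΩ hx'), zero_mul]
      rw [h3] at h1
      rw [h1, neg_neg]
      exact (setIntegral_eq_integral_of_forall_compl_eq_zero
        fun x hx => by simp [hG0 x hx]).symm
    have hI1 : Integrable (fun p : EuclideanSpace ℝ (Fin d) × ℝ => φ p.1 * G (p.1 + p.2 • h))
        (volume.prod (volume.restrict (Icc (0 : ℝ) 1))) :=
      hGp.bdd_mul (c := C) (by fun_prop) (Eventually.of_forall fun p => hC p.1)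
    have hI2 : Integrable (fun p : EuclideanSpace ℝ (Fin d) × ℝ =>
        v p.1 * fderiv ℝ φ (p.1 - p.2 • h) h)
        (volume.prod (volume.restrict (Icc (0 : ℝ) 1))) :=
      (hvi.comp_fst _).mul_bdd (c := C')
        (hdc.comp (by fun_prop : Continuous fun p : EuclideanSpace ℝ (Fin d) × ℝ =>
          p.1 - p.2 • h)).aestronglyMeasurable
        (Eventually.of_forall fun p => hC' _)
    have hL : ∫ x, φ x * ∫ s in Icc (0 : ℝ) 1, G (x + s • h)
        = ∫ s in Icc (0 : ℝ) 1, ∫ x, G x * φ (x - s • h) := by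
      simp_rw [← integral_const_mul]
      rw [integral_integral_swap hI1]
      refine integral_congr_ae (Eventually.of_forall fun s => ?_)
      simp only
      rw [← integral_add_right_eq_self (fun x => G x * φ (x - s • h)) (s • h)]
      simp [mul_comm]
    -- Integrating the derivative in `s` from `0` to `1` leaves only the two end translates of `φ`.
    have hR : ∫ s in Icc (0 : ℝ) 1, ∫ x, G x * φ (x - s • h)
        = ∫ x, v x * (φ (x - h) - φ x) := by
      rw [setIntegral_congr_fun measurableSet_Icc hA, integral_neg,
        ← integral_integral_swap hI2, ← integral_neg]
      refine integral_congr_ae (Eventually.of_forall fun x => ?_)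
      simp only
      rw [integral_const_mul, ← mul_neg]
      congr 1
      have hder : ∀ s ∈ uIcc (0 : ℝ) 1, HasDerivAt (fun s : ℝ => φ (x - s • h))
          (-(fderiv ℝ φ (x - s • h) h)) s := by
        intro s _
        have h1 : HasDerivAt (fun s : ℝ => x - s • h) (-h) s := by
          simpa using ((hasDerivAt_id s).smul_const h).const_sub x
        have h2 := ((hφ.differentiable (by simp)) (x - s • h)).hasFDerivAt.comp_hasDerivAt s h1
        exact h2.congr_deriv (by simp)
      have hint : IntervalIntegrable (fun s : ℝ => -(fderiv ℝ φ (x - s • h) h)) volume 0 1 :=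
        ((hdc.comp (by fun_prop : Continuous fun s : ℝ => x - s • h)).neg).intervalIntegrable _ _
      have h3 := intervalIntegral.integral_eq_sub_of_hasDerivAt hder hint
      rw [intervalIntegral.integral_of_le zero_le_one, ← integral_Icc_eq_integral_Ioc,
        integral_neg] at h3
      simpa using h3
    have hT : ∫ x, φ x * u (x + h) = ∫ x, v x * φ (x - h) := by
      rw [← integral_add_right_eq_self (fun x => v x * φ (x - h)) h]
      refine integral_congr_ae (Eventually.of_forall fun x => ?_)
      simp only
      rw [← hvu]
      · simp [mul_comm]
      · intro hx
        refine image_eq_zero_of_notMem_tsupport ?_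
        simpa using hKmem 1 (by simp) _ hx
    have hT0 : ∫ x, φ x * u x = ∫ x, v x * φ x := by
      refine integral_congr_ae (Eventually.of_forall fun x => ?_)
      simp only
      rw [mul_comm, hvu]
      intro hx
      refine image_eq_zero_of_notMem_tsupport ?_
      simpa using hKmem 0 (by simp) _ hx
    have i1 : Integrable fun x => φ x * u (x + h) := by
      have := integrableOn_mul_of_compact hu1 hφ.continuous hc hs
      refine (IntegrableOn.integrable_of_forall_notMem_eq_zero this fun x hx => ?_).congr
        (Eventually.of_forall fun x => mul_comm _ _)
      simp [image_eq_zero_of_notMem_tsupport fun hx' => hx (hs hx')]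
    have i2 : Integrable fun x => φ x * u x := by
      have := integrableOn_mul_of_compact (hu.mono_set hUsub) hφ.continuous hc hs
      refine (IntegrableOn.integrable_of_forall_notMem_eq_zero this fun x hx => ?_).congr
        (Eventually.of_forall fun x => mul_comm _ _)
      simp [image_eq_zero_of_notMem_tsupport fun hx' => hx (hs hx')]
    have i3 : Integrable fun x => φ x * ∫ s in Icc (0 : ℝ) 1, G (x + s • h) :=
      hGp.integral_prod_left.bdd_mul (c := C) hφ.continuous.aestronglyMeasurable
        (Eventually.of_forall hC)
    have i4 : Integrable fun x => v x * φ (x - h) :=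
      hvi.mul_bdd (c := C) (hφ.continuous.comp (by fun_prop)).aestronglyMeasurable
        (Eventually.of_forall fun x => hC _)
    have i5 : Integrable fun x => v x * φ x :=
      hvi.mul_bdd (c := C) hφ.continuous.aestronglyMeasurable (Eventually.of_forall hC)
    simp only [smul_eq_mul, mul_sub] at hR ⊢
    rw [integral_sub (f := fun x => φ x * u (x + h) - φ x * u x) (i1.sub i2) i3, integral_sub i1 i2, hL, hR, hT, hT0, integral_sub i4 i5,
      sub_self]
  filter_upwards [hU.ae_eq_zero_of_integral_contDiff_smul_eq_zero hD main] with x hx hxU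
  exact sub_eq_zero.1 (hx hxU)

/-! ### Representation on vertical segments -/

/-- The domain of integration varies with the point, so it is encoded by the indicator of a
measurable set in all variables; the factor `±1` is the orientation of the interval integral. -/
theorem stronglyMeasurable_primitive {α : Type*} [MeasurableSpace α] {g : α × ℝ → ℝ}
    (hg : StronglyMeasurable g) (a : ℝ) :
    StronglyMeasurable fun p : α × ℝ => ∫ s in a..p.2, g (p.1, s) := by
  simp_rw [intervalIntegral.intervalIntegral_eq_integral_uIoc, ← integral_indicator
    (measurableSet_uIoc (α := ℝ))]
  refine StronglyMeasurable.smul (f := fun p : α × ℝ => if a ≤ p.2 then (1 : ℝ) else -1)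
    (StronglyMeasurable.ite (measurableSet_le measurable_const measurable_snd)
      stronglyMeasurable_const stronglyMeasurable_const) ?_
  have hS : MeasurableSet {q : (α × ℝ) × ℝ | q.2 ∈ uIoc a q.1.2} := by
    have h1 : Measurable fun q : (α × ℝ) × ℝ => min a q.1.2 := by fun_prop
    have h2 : Measurable fun q : (α × ℝ) × ℝ => max a q.1.2 := by fun_prop
    exact (measurableSet_lt h1 measurable_snd).inter (measurableSet_le measurable_snd h2)
  have h := (hg.comp_measurable (g := fun q : (α × ℝ) × ℝ => (q.1.1, q.2)) (by fun_prop)).indicator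
    hS
  exact h.integral_prod_right (f := fun (p : α × ℝ) s => (uIoc a p.2).indicator
    (fun s => g (p.1, s)) s)

/-- A function on `α × ℝ` that is invariant, on a slab `α × J`, under every translation of the
last variable depends, on the slab, on the first variable only. -/
theorem exists_ae_eq_of_forall_translate {α : Type*} [MeasurableSpace α] {μ : Measure α}
    [SFinite μ] {F : α × ℝ → ℝ} (hF : StronglyMeasurable F) {J : Set ℝ} (hJ : MeasurableSet J)
    (hJ0 : volume J ≠ 0)
    (h : ∀ τ : ℝ, ∀ᵐ p ∂μ.prod volume, p.2 ∈ J → p.2 + τ ∈ J → F (p.1, p.2 + τ) = F p) :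
    ∃ t₀ ∈ J, ∀ᵐ p ∂μ.prod volume, p.2 ∈ J → F p = F (p.1, t₀) := by
  have hFm := hF.measurable
  have m1 : MeasurableSet {q : (ℝ × α) × ℝ |
      q.2 ∈ J → q.2 + q.1.1 ∈ J → F (q.1.2, q.2 + q.1.1) = F (q.1.2, q.2)} := by
    refine MeasurableSet.imp (hJ.preimage measurable_snd) (MeasurableSet.imp
      (hJ.preimage (by fun_prop : Measurable fun q : (ℝ × α) × ℝ => q.2 + q.1.1)) ?_)
    exact measurableSet_eq_fun (hFm.comp (by fun_prop)) (hFm.comp (by fun_prop))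
  -- The exceptional set in `h` depends on `τ`. Fubini on the triples `(τ, x, t)` exchanges the
  -- quantifiers: almost every `t` is good for almost every `(τ, x)`.
  have h1 : ∀ᵐ q ∂(volume : Measure ℝ).prod μ, ∀ᵐ t : ℝ,
      t ∈ J → t + q.1 ∈ J → F (q.2, t + q.1) = F (q.2, t) := by
    have m0 : MeasurableSet {q : ℝ × α | ∀ᵐ t : ℝ,
        t ∈ J → t + q.1 ∈ J → F (q.2, t + q.1) = F (q.2, t)} :=
      measurable_measure_prodMk_left (ν := (volume : Measure ℝ)) m1.compl
        (measurableSet_singleton 0)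
    rw [Measure.ae_prod_iff_ae_ae m0]
    exact Eventually.of_forall fun τ => Measure.ae_ae_of_ae_prod (h τ)
  rw [Measure.ae_ae_comm m1] at h1
  obtain ⟨t₀, ht₀J, ht₀⟩ : ∃ t₀ ∈ J, ∀ᵐ q ∂(volume : Measure ℝ).prod μ,
      t₀ ∈ J → t₀ + q.1 ∈ J → F (q.2, t₀ + q.1) = F (q.2, t₀) := by
    by_contra hcon
    push Not at hcon
    refine hJ0 (measure_mono_null (fun t ht => ?_) (ae_iff.1 h1))
    rw [mem_ofPred_eq]
    intro hc
    obtain ⟨q, hq, hq'⟩ := ((hcon t ht).and_eventually hc).exists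
    exact hq.2.2 (hq' hq.1 hq.2.1)
  refine ⟨t₀, ht₀J, ?_⟩
  -- Substitute `τ = t - t₀`.
  have h2 : ∀ᵐ t : ℝ, ∀ᵐ x ∂μ, t ∈ J → F (x, t) = F (x, t₀) := by
    have h3 := (measurePreserving_sub_right volume t₀).quasiMeasurePreserving.ae
      (Measure.ae_ae_of_ae_prod ht₀)
    filter_upwards [h3] with t ht
    filter_upwards [ht] with x hx htJ
    simpa [htJ] using hx ht₀J
  have m2 : MeasurableSet {q : ℝ × α | q.1 ∈ J → F (q.2, q.1) = F (q.2, t₀)} :=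
    MeasurableSet.imp (hJ.preimage measurable_fst)
      (measurableSet_eq_fun (hFm.comp (by fun_prop)) (hFm.comp (by fun_prop)))
  have m3 : MeasurableSet {p : α × ℝ | p.2 ∈ J → F p = F (p.1, t₀)} :=
    MeasurableSet.imp (hJ.preimage measurable_snd)
      (measurableSet_eq_fun hFm (hFm.comp (by fun_prop)))
  rw [Measure.ae_prod_iff_ae_ae m3]
  exact (Measure.ae_ae_comm m2).1 h2

/-- Data of a weakly differentiable function on the strip with a representative `V` of the
gradient that is measurable, integrable and extended by zero. -/
structure IsStripGradient (n : ℕ) (bm bp : ℝ) (u : EuclideanSpace ℝ (Fin (n + 1)) → ℝ)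
    (V : EuclideanSpace ℝ (Fin (n + 1)) → EuclideanSpace ℝ (Fin (n + 1))) : Prop where
  lt : bm < bp
  meas : StronglyMeasurable u
  locInt : LocallyIntegrableOn u (strip n bm bp)
  grad_meas : StronglyMeasurable V
  grad_int : Integrable V
  grad_zero : ∀ x ∉ strip n bm bp, V x = 0
  weak : ∀ i, HasWeakPartial (strip n bm bp) i u fun x => V x i

/-- The last component of a vector field, as a function of `(x', t)`. -/
def lastPart {n : ℕ} (V : EuclideanSpace ℝ (Fin (n + 1)) → EuclideanSpace ℝ (Fin (n + 1)))
    (p : EuclideanSpace ℝ (Fin n) × ℝ) : ℝ :=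
  V (withLast p.1 p.2) (Fin.last n)

namespace IsStripGradient

variable {n : ℕ} {bm bp : ℝ} {u : EuclideanSpace ℝ (Fin (n + 1)) → ℝ}
  {V : EuclideanSpace ℝ (Fin (n + 1)) → EuclideanSpace ℝ (Fin (n + 1))}

theorem stronglyMeasurable_lastPart (h : IsStripGradient n bm bp u V) :
    StronglyMeasurable (lastPart V) :=
  ((EuclideanSpace.proj (Fin.last n) : EuclideanSpace ℝ (Fin (n + 1)) →L[ℝ] ℝ).continuous
    |>.comp_stronglyMeasurable h.grad_meas).comp_measurable continuous_withLast.measurable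

theorem integrable_comp_withLast {f : EuclideanSpace ℝ (Fin (n + 1)) → ℝ} (hf : Integrable f) :
    Integrable fun p : EuclideanSpace ℝ (Fin n) × ℝ => f (withLast p.1 p.2) :=
  ((measurePreserving_withLast n).integrable_comp_emb (measurableEmbedding_withLast n)).2 hf

theorem integrable_lastPart (h : IsStripGradient n bm bp u V) : Integrable (lastPart V) :=
  integrable_comp_withLast
    ((EuclideanSpace.proj (Fin.last n) : EuclideanSpace ℝ (Fin (n + 1)) →L[ℝ] ℝ).integrable_comp
      h.grad_int)

theorem ae_integrable_lastPart (h : IsStripGradient n bm bp u V) :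
    ∀ᵐ x' : EuclideanSpace ℝ (Fin n), Integrable fun s => lastPart V (x', s) :=
  h.integrable_lastPart.prod_right_ae

/-- The theorem along segments is applied to `τ • e` with `e` vertical, on the open set where both
ends lie in the strip; convexity of the interval keeps the segment inside. The substitution `r = p.2
+ τ * s` gives the stated integral, also for negative `τ`. -/
theorem ae_translate_last (h : IsStripGradient n bm bp u V) (τ : ℝ) :
    ∀ᵐ p : EuclideanSpace ℝ (Fin n) × ℝ, p.2 ∈ Ioo bm bp → p.2 + τ ∈ Ioo bm bp →
      u (withLast p.1 (p.2 + τ)) - u (withLast p.1 p.2)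
        = ∫ s in p.2..p.2 + τ, lastPart V (p.1, s) := by
  set e : EuclideanSpace ℝ (Fin (n + 1)) := withLast 0 1 with he
  have hl : ∀ (x : EuclideanSpace ℝ (Fin (n + 1))) (s : ℝ),
      (x + s • τ • e) (Fin.last n) = x (Fin.last n) + s * τ := by
    intro x s; simp [he]
  have hU : IsOpen {x : EuclideanSpace ℝ (Fin (n + 1)) | x (Fin.last n) ∈ Ioo bm bp ∧
      x (Fin.last n) + τ ∈ Ioo bm bp} :=
    (isOpen_strip n bm bp).inter (isOpen_Ioo.preimage (by fun_prop :
      Continuous fun x : EuclideanSpace ℝ (Fin (n + 1)) => x (Fin.last n) + τ))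
  have key := ae_sub_eq_integral_inner h.locInt h.grad_meas h.grad_int h.grad_zero h.weak hU
    (τ • e) (by
      rintro x ⟨hx1, hx2⟩ s ⟨hs0, hs1⟩
      change _ ∈ Ioo bm bp
      rw [hl]
      have := (convex_Ioo bm bp) hx1 hx2 (sub_nonneg.2 hs1) hs0 (by ring)
      convert! this using 1
      simp only [smul_eq_mul]; ring)
  filter_upwards [(measurePreserving_withLast n).quasiMeasurePreserving.ae key] with p hp h1 h2
  have hp' := hp ⟨by simpa using h1, by simpa using h2⟩
  have hadd : ∀ s : ℝ, withLast p.1 p.2 + s • e = withLast p.1 (p.2 + s) := fun s => by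
    rw [he, ← withLast_smul, ← withLast_add]; simp
  rw [hadd] at hp'
  rw [hp', integral_Icc_eq_integral_Ioc, ← intervalIntegral.integral_of_le zero_le_one]
  have hin : ∀ s : ℝ, inner ℝ (V (withLast p.1 p.2 + s • τ • e)) (τ • e)
      = τ * lastPart V (p.1, p.2 + τ * s) := by
    intro s
    rw [smul_smul, hadd, inner_smul_right, he, withLast_zero_one, EuclideanSpace.inner_single_right]
    simp [lastPart, mul_comm]
  simp_rw [hin]
  rw [intervalIntegral.integral_const_mul,
    intervalIntegral.mul_integral_comp_add_mul (f := fun r => lastPart V (p.1, r))]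
  simp

/-- On almost every vertical segment, `u` is a primitive of its last weak derivative. -/
theorem exists_vertical_representation (h : IsStripGradient n bm bp u V) :
    ∃ f : EuclideanSpace ℝ (Fin n) → ℝ, StronglyMeasurable f ∧
      ∀ᵐ p : EuclideanSpace ℝ (Fin n) × ℝ, p.2 ∈ Ioo bm bp →
        u (withLast p.1 p.2) = f p.1 + ∫ s in bm..p.2, lastPart V (p.1, s) := by
  -- By `ae_translate_last`, `u` minus its vertical primitive is invariant under vertical
  -- translations, hence a function of `x'` alone.
  set F : EuclideanSpace ℝ (Fin n) × ℝ → ℝ := fun p =>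
    u (withLast p.1 p.2) - ∫ s in bm..p.2, lastPart V (p.1, s) with hF
  have hFm : StronglyMeasurable F :=
    (h.meas.comp_measurable continuous_withLast.measurable).sub
      (stronglyMeasurable_primitive h.stronglyMeasurable_lastPart bm)
  obtain ⟨t₀, -, ht₀⟩ := exists_ae_eq_of_forall_translate
    (μ := (volume : Measure (EuclideanSpace ℝ (Fin n)))) hFm (measurableSet_Ioo (a := bm) (b := bp))
    (by simp [h.lt]) (fun τ => by
      have hi : ∀ᵐ p : EuclideanSpace ℝ (Fin n) × ℝ, Integrable fun s => lastPart V (p.1, s) :=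
        Measure.quasiMeasurePreserving_fst.ae h.ae_integrable_lastPart
      filter_upwards [h.ae_translate_last τ, hi] with p hp hpi h1 h2
      have := hp h1 h2
      have hadd := intervalIntegral.integral_add_adjacent_intervals
        (hpi.intervalIntegrable (a := bm) (b := p.2))
        (hpi.intervalIntegrable (a := p.2) (b := p.2 + τ))
      simp only [hF]
      linarith)
  refine ⟨fun x' => F (x', t₀), hFm.comp_measurable (by fun_prop), ?_⟩
  filter_upwards [ht₀] with p hp hpI
  rw [← hp hpI, hF]
  ring

end IsStripGradient

/-! ### Traces at a given height by vertical integration -/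

/-- Integration by parts against a primitive of an integrable function. -/
theorem integral_primitive_mul_deriv {g Ψ Ψ' : ℝ → ℝ} (hg : Integrable g)
    (hΨ : ∀ t, HasDerivAt Ψ (Ψ' t) t) (hΨ' : Continuous Ψ') (c a b : ℝ) :
    ∫ t in a..b, (c + ∫ s in a..t, g s) * Ψ' t
      = (c + ∫ s in a..b, g s) * Ψ b - c * Ψ a - ∫ t in a..b, Ψ t * g t := by
  have hgi : IntervalIntegrable g volume a b := hg.intervalIntegrable
  have hw := hgi.absolutelyContinuousOnInterval_intervalIntegral (c := a) left_mem_uIcc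
  have hΨi : IntervalIntegrable Ψ' volume a b := hΨ'.intervalIntegrable _ _
  have hΨc : Continuous Ψ := continuous_iff_continuousAt.2 fun t => (hΨ t).continuousAt
  have hΨint : ∀ t, ∫ s in a..t, Ψ' s = Ψ t - Ψ a := fun t =>
    intervalIntegral.integral_eq_sub_of_hasDerivAt (fun s _ => hΨ s) (hΨ'.intervalIntegrable _ _)
  -- As `g` is only integrable, the absolutely continuous form of integration by parts is used.
  -- Subtracting `Ψ a` exhibits the second factor as a primitive of `Ψ'`.
  have hΨac : AbsolutelyContinuousOnInterval (fun t => Ψ t - Ψ a) a b := by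
    simp_rw [← hΨint]
    exact hΨi.absolutelyContinuousOnInterval_intervalIntegral (c := a) left_mem_uIcc
  have h1 := hw.integral_mul_deriv_eq_deriv_mul hΨac
  have hd : ∀ t, deriv (fun t => Ψ t - Ψ a) t = Ψ' t := fun t => ((hΨ t).sub_const _).deriv
  simp_rw [hd] at h1
  have h2 : ∫ t in a..b, deriv (fun t => ∫ s in a..t, g s) t * (Ψ t - Ψ a)
      = ∫ t in a..b, (Ψ t * g t - Ψ a * g t) := by
    refine intervalIntegral.integral_congr_ae ?_
    filter_upwards [hgi.ae_hasDerivAt_integral] with t ht htm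
    rw [(ht (uIoc_subset_uIcc htm) a left_mem_uIcc).deriv]
    ring
  have i1 : IntervalIntegrable (fun t => Ψ t * g t) volume a b :=
    hgi.continuousOn_mul hΨc.continuousOn
  rw [h2, intervalIntegral.integral_sub i1 (hgi.const_mul _),
    intervalIntegral.integral_const_mul] at h1
  have i2 : IntervalIntegrable (fun t => (∫ s in a..t, g s) * Ψ' t) volume a b :=
    (hΨ'.intervalIntegrable a b).continuousOn_mul hw.continuousOn
  simp_rw [add_mul]
  rw [intervalIntegral.integral_add (hΨi.const_mul _) i2, h1, intervalIntegral.integral_const_mul,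
    hΨint]
  simp
  ring

/-- A trace on the bottom face: `u` is recovered from it by vertical integration. -/
structure IsBottomTrace (n : ℕ) (bm bp : ℝ) (u : EuclideanSpace ℝ (Fin (n + 1)) → ℝ)
    (V : EuclideanSpace ℝ (Fin (n + 1)) → EuclideanSpace ℝ (Fin (n + 1)))
    (f : EuclideanSpace ℝ (Fin n) → ℝ) : Prop extends IsStripGradient n bm bp u V where
  trace_meas : StronglyMeasurable f
  rep : ∀ᵐ p : EuclideanSpace ℝ (Fin n) × ℝ, p.2 ∈ Ioo bm bp →
        u (withLast p.1 p.2) = f p.1 + ∫ s in bm..p.2, lastPart V (p.1, s)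

/-- The trace at height `b`, in terms of the trace `f` on the bottom face. -/
def traceAt {n : ℕ} (bm : ℝ) (V : EuclideanSpace ℝ (Fin (n + 1)) → EuclideanSpace ℝ (Fin (n + 1)))
    (f : EuclideanSpace ℝ (Fin n) → ℝ) (b : ℝ) (x' : EuclideanSpace ℝ (Fin n)) : ℝ :=
  f x' + ∫ s in bm..b, lastPart V (x', s)

theorem traceAt_bottom {n : ℕ} (bm : ℝ)
    (V : EuclideanSpace ℝ (Fin (n + 1)) → EuclideanSpace ℝ (Fin (n + 1)))
    (f : EuclideanSpace ℝ (Fin n) → ℝ) : traceAt bm V f bm = f := by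
  funext x'; simp [traceAt]

namespace IsBottomTrace

variable {n : ℕ} {bm bp : ℝ} {u : EuclideanSpace ℝ (Fin (n + 1)) → ℝ}
  {V : EuclideanSpace ℝ (Fin (n + 1)) → EuclideanSpace ℝ (Fin (n + 1))}
  {f : EuclideanSpace ℝ (Fin n) → ℝ}

/-- This integrable function of `x'` dominates the vertical primitives between any two heights, and
so serves as the majorant below. -/
theorem integrable_abs_lastPart (h : IsBottomTrace n bm bp u V f) :
    Integrable fun x' : EuclideanSpace ℝ (Fin n) => ∫ s, |lastPart V (x', s)| :=
  h.integrable_lastPart.norm.integral_prod_left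

theorem ae_abs_integral_le (h : IsBottomTrace n bm bp u V f) :
    ∀ᵐ x' : EuclideanSpace ℝ (Fin n), ∀ a b : ℝ,
      |∫ s in a..b, lastPart V (x', s)| ≤ ∫ s, |lastPart V (x', s)| := by
  filter_upwards [h.ae_integrable_lastPart] with x' hx a b
  rw [← Real.norm_eq_abs]
  refine intervalIntegral.norm_integral_le_integral_norm_uIoc.trans ?_
  exact setIntegral_le_integral hx.norm (Eventually.of_forall fun s => norm_nonneg _)

theorem rep_restrict (h : IsBottomTrace n bm bp u V f) :
    ∀ᵐ p ∂(volume : Measure (EuclideanSpace ℝ (Fin n))).prod (volume.restrict (Ioo bm bp)),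
      u (withLast p.1 p.2) = f p.1 + ∫ s in bm..p.2, lastPart V (p.1, s) := by
  rw [← Measure.restrict_univ (μ := (volume : Measure (EuclideanSpace ℝ (Fin n)))),
    Measure.prod_restrict, ae_restrict_iff' (MeasurableSet.univ.prod measurableSet_Ioo)]
  filter_upwards [h.rep] with p hp hpm
  exact hp hpm.2

/-- Over `K ×ˢ Icc a b`, compactly inside the strip, both `u` and the primitive are integrable,
hence so is `f` viewed as a function of `(x', t)`. As `Icc a b` has positive length, `f` is
integrable on `K`. -/
theorem locallyIntegrable (h : IsBottomTrace n bm bp u V f) : LocallyIntegrable f := by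
  rw [locallyIntegrable_iff]
  intro K hK
  obtain ⟨a, hma, hap⟩ := exists_between h.lt
  obtain ⟨b, hab, hbp⟩ := exists_between hap
  have hsub : Icc a b ⊆ Ioo bm bp := fun t ht => ⟨hma.trans_le ht.1, ht.2.trans_lt hbp⟩
  set L : Set (EuclideanSpace ℝ (Fin (n + 1))) := (fun p : EuclideanSpace ℝ (Fin n) × ℝ =>
    withLast p.1 p.2) '' (K ×ˢ Icc a b) with hL
  have hLi : IntegrableOn u L := by
    refine h.locInt.integrableOn_compact_subset ?_ ((hK.prod isCompact_Icc).image (by fun_prop))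
    rintro _ ⟨p, hp, rfl⟩
    simpa [strip_eq] using hsub hp.2
  have hLi' : Integrable (fun p : EuclideanSpace ℝ (Fin n) × ℝ => u (withLast p.1 p.2))
      ((volume.restrict K).prod (volume.restrict (Icc a b))) := by
    rw [Measure.prod_restrict]
    exact ((measurePreserving_withLast n).integrableOn_image (measurableEmbedding_withLast n)).1 hLi
  have hw : Integrable (fun p : EuclideanSpace ℝ (Fin n) × ℝ =>
      ∫ s in bm..p.2, lastPart V (p.1, s)) ((volume.restrict K).prod (volume.restrict (Icc a b))) := by
    refine Integrable.mono' ((h.integrable_abs_lastPart.restrict (s := K)).comp_fst _)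
      (stronglyMeasurable_primitive h.stronglyMeasurable_lastPart bm).aestronglyMeasurable ?_
    filter_upwards [Measure.quasiMeasurePreserving_fst.ae
      (ae_restrict_of_ae (s := K) h.ae_abs_integral_le)] with p hp
    exact hp _ _
  have hf : Integrable (fun p : EuclideanSpace ℝ (Fin n) × ℝ => f p.1)
      ((volume.restrict K).prod (volume.restrict (Icc a b))) := by
    refine (hLi'.sub hw).congr ?_
    rw [Measure.prod_restrict]
    filter_upwards [ae_restrict_of_ae h.rep,
      ae_restrict_mem (hK.measurableSet.prod measurableSet_Icc)] with p hp hpm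
    simp [hp (hsub hpm.2)]
  exact hf.of_comp_fst (by simpa [Measure.restrict_eq_zero] using hab)

theorem integrable_primitive (h : IsBottomTrace n bm bp u V f) (b : ℝ) :
    Integrable fun x' : EuclideanSpace ℝ (Fin n) => ∫ s in bm..b, lastPart V (x', s) := by
  refine Integrable.mono' h.integrable_abs_lastPart
    ((stronglyMeasurable_primitive h.stronglyMeasurable_lastPart bm).comp_measurable
      (by fun_prop : Measurable fun x' => (x', b))).aestronglyMeasurable ?_
  filter_upwards [h.ae_abs_integral_le] with x' hx
  exact hx _ _

theorem locallyIntegrable_traceAt (h : IsBottomTrace n bm bp u V f) (b : ℝ) :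
    LocallyIntegrable (traceAt bm V f b) :=
  h.locallyIntegrable.add (h.integrable_primitive b).locallyIntegrable

/-- `u` times a bounded function supported over a compact set is integrable on the strip. -/
theorem integrable_prod_mul (h : IsBottomTrace n bm bp u V f)
    {θ : EuclideanSpace ℝ (Fin (n + 1)) → ℝ} (hθ : Continuous θ) (hc : HasCompactSupport θ) :
    Integrable (fun p : EuclideanSpace ℝ (Fin n) × ℝ =>
      u (withLast p.1 p.2) * θ (withLast p.1 p.2))
      (volume.prod (volume.restrict (Ioo bm bp))) := by
  obtain ⟨C, hC⟩ := hc.exists_bound_of_continuous hθ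
  set K : Set (EuclideanSpace ℝ (Fin n)) := (fun x => ((withLastL n).symm x).1) '' tsupport θ with hK
  have hKc : IsCompact K := IsCompact.image hc (by fun_prop)
  have hK0 : ∀ p : EuclideanSpace ℝ (Fin n) × ℝ, p.1 ∉ K → θ (withLast p.1 p.2) = 0 := by
    intro p hp
    refine image_eq_zero_of_notMem_tsupport fun hp' => hp ⟨_, hp', ?_⟩
    simp [← withLastL_apply]
  -- The majorant `C * (1_K |f| + ∫ |∂_N u|)` does not depend on `t`, so it is integrable over the
  -- bounded interval. This gives integrability up to the faces, where `u` is not assumed locally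
  -- integrable.
  have hfK : Integrable (K.indicator fun x' => |f x'|) :=
    (integrable_indicator_iff hKc.measurableSet).2 (h.locallyIntegrable.integrableOn_isCompact hKc).abs
  refine Integrable.mono' (((hfK.add h.integrable_abs_lastPart).const_mul C).comp_fst _)
    ((h.meas.comp_measurable continuous_withLast.measurable).aestronglyMeasurable.mul
      (hθ.comp continuous_withLast).aestronglyMeasurable) ?_
  filter_upwards [h.rep_restrict, Measure.quasiMeasurePreserving_fst.ae h.ae_abs_integral_le]
    with p hp hp2
  have hC0 : 0 ≤ C := (norm_nonneg _).trans (hC 0)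
  by_cases hpK : p.1 ∈ K
  · rw [hp, norm_mul, mul_comm]
    have h1 : ‖f p.1 + ∫ s in bm..p.2, lastPart V (p.1, s)‖
        ≤ |f p.1| + ∫ s, |lastPart V (p.1, s)| :=
      (norm_add_le _ _).trans (add_le_add le_rfl (hp2 _ _))
    simp only [Pi.add_apply, indicator_of_mem hpK]
    exact mul_le_mul (hC _) h1 (norm_nonneg _) hC0
  · rw [hK0 p hpK, mul_zero, norm_zero]
    simp only [Pi.add_apply, indicator_of_notMem hpK, zero_add]
    exact mul_nonneg hC0 (integral_nonneg fun s => abs_nonneg _)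

theorem integrableOn_mul (h : IsBottomTrace n bm bp u V f)
    {θ : EuclideanSpace ℝ (Fin (n + 1)) → ℝ} (hθ : Continuous θ) (hc : HasCompactSupport θ) :
    IntegrableOn (fun x => u x * θ x) (strip n bm bp) :=
  ((measurePreserving_withLast_restrict measurableSet_Ioo).integrable_comp_emb
    (measurableEmbedding_withLast n)).1 (h.integrable_prod_mul hθ hc)

/-- The trace agrees with the boundary values of a function continuous up to the boundary. -/
theorem traceAt_ae_eq_of_continuousOn (h : IsBottomTrace n bm bp u V f)
    {v : EuclideanSpace ℝ (Fin (n + 1)) → ℝ} (hv : ContinuousOn v (closure (strip n bm bp)))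
    (huv : u =ᵐ[volume.restrict (strip n bm bp)] v) :
    ∀ᵐ x' : EuclideanSpace ℝ (Fin n), ∀ b ∈ Icc bm bp, traceAt bm V f b x' = v (withLast x' b) := by
  have h1 : ∀ᵐ p ∂(volume : Measure (EuclideanSpace ℝ (Fin n))).prod (volume.restrict (Ioo bm bp)),
      u (withLast p.1 p.2) = v (withLast p.1 p.2) :=
    (measurePreserving_withLast_restrict (n := n)
      (measurableSet_Ioo (a := bm) (b := bp))).quasiMeasurePreserving.ae huv
  filter_upwards [Measure.ae_ae_of_ae_prod (h1.and h.rep_restrict), h.ae_integrable_lastPart]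
    with x' hx hxi b hb
  -- Two continuous functions that agree a.e. on the closed interval agree at its endpoints too.
  rw [Measure.restrict_congr_set Ioo_ae_eq_Icc] at hx
  refine Measure.eqOn_Icc_of_ae_eq (μ := volume) h.lt.ne (f := fun b => traceAt bm V f b x')
    (g := fun b => v (withLast x' b)) ?_ ?_ ?_ hb
  · filter_upwards [hx] with t ht
    rw [traceAt, ← ht.2, ht.1]
  · exact (continuous_const.add (intervalIntegral.continuous_primitive
      (fun a b => hxi.intervalIntegrable) bm)).continuousOn
  · refine hv.comp (continuous_withLast.comp (by fun_prop : Continuous fun b : ℝ =>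
      (x', b))).continuousOn fun t ht => ?_
    rw [closure_strip h.lt]
    simpa using ht

theorem lintegral_strip_eq {G : EuclideanSpace ℝ (Fin (n + 1)) → ℝ≥0∞} {J : Set ℝ}
    (hJ : MeasurableSet J) (hG : Measurable G) :
    ∫⁻ x in {x | x (Fin.last n) ∈ J}, G x
      = ∫⁻ x' : EuclideanSpace ℝ (Fin n), ∫⁻ t in J, G (withLast x' t) := by
  rw [← (measurePreserving_withLast_restrict hJ).lintegral_comp hG]
  exact lintegral_prod _ (hG.comp continuous_withLast.measurable).aemeasurable

theorem measurable_lastPart (h : IsBottomTrace n bm bp u V f) :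
    Measurable fun x => ‖V x (Fin.last n)‖ₑ :=
  ((EuclideanSpace.proj (Fin.last n) : EuclideanSpace ℝ (Fin (n + 1)) →L[ℝ] ℝ).continuous
    |>.comp_stronglyMeasurable h.grad_meas).enorm

/-- The difference of two traces is controlled by the vertical derivative in between. -/
theorem enorm_traceAt_sub_le (x' : EuclideanSpace ℝ (Fin n))
    (hx : Integrable fun s => lastPart V (x', s)) {a b s t : ℝ} (hs : s ∈ Icc a b)
    (ht : t ∈ Icc a b) :
    ‖traceAt bm V f t x' - traceAt bm V f s x'‖ₑ
      ≤ ∫⁻ r in Ioo a b, ‖V (withLast x' r) (Fin.last n)‖ₑ := by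
  have h1 : traceAt bm V f t x' - traceAt bm V f s x' = ∫ r in s..t, lastPart V (x', r) := by
    rw [traceAt, traceAt, add_sub_add_left_eq_sub]
    exact intervalIntegral.integral_interval_sub_left hx.intervalIntegrable hx.intervalIntegrable
  rw [h1, ← enorm_norm, intervalIntegral.norm_integral_eq_norm_integral_uIoc, enorm_norm]
  refine (enorm_integral_le_lintegral_enorm _).trans ?_
  rw [Measure.restrict_congr_set (Ioo_ae_eq_Icc (a := a) (b := b))]
  refine lintegral_mono_set (uIoc_subset_uIcc.trans ?_)
  exact uIcc_subset_Icc hs ht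

theorem lintegral_jump_le (h : IsBottomTrace n bm bp u V f) :
    ∫⁻ x', ‖traceAt bm V f bp x' - traceAt bm V f bm x'‖ₑ
      ≤ ∫⁻ x in strip n bm bp, ‖V x (Fin.last n)‖ₑ := by
  rw [strip_eq, lintegral_strip_eq measurableSet_Ioo h.measurable_lastPart]
  refine lintegral_mono_ae ?_
  filter_upwards [h.ae_integrable_lastPart] with x' hx
  exact enorm_traceAt_sub_le x' hx (left_mem_Icc.2 h.lt.le) (right_mem_Icc.2 h.lt.le)

end IsBottomTrace

/-! ### Vertical integration by parts -/

theorem continuous_partialDeriv_of_contDiff_one {d : ℕ} (i : Fin d)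
    {φ : EuclideanSpace ℝ (Fin d) → ℝ} (hφ : ContDiff ℝ 1 φ) : Continuous (partialDeriv i φ) :=
  (hφ.continuous_fderiv one_ne_zero).clm_apply continuous_const

theorem hasCompactSupport_partialDeriv {d : ℕ} (i : Fin d)
    {φ : EuclideanSpace ℝ (Fin d) → ℝ} (hφ : HasCompactSupport φ) :
    HasCompactSupport (partialDeriv i φ) :=
  hφ.fderiv_apply ℝ _

theorem integrable_withLast_mul {n : ℕ} {ψ : EuclideanSpace ℝ (Fin (n + 1)) → ℝ}
    (hψ : Continuous ψ) (hc : HasCompactSupport ψ) (b : ℝ) {T : EuclideanSpace ℝ (Fin n) → ℝ}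
    (hT : LocallyIntegrable T) : Integrable fun x' => ψ (withLast x' b) * T x' :=
  hT.integrable_smul_left_of_hasCompactSupport
    (hψ.comp (continuous_withLast.comp (by fun_prop : Continuous fun x' => (x', b))))
    (hc.comp_isClosedEmbedding (isometry_withLast b).isClosedEmbedding)

namespace IsBottomTrace

variable {n : ℕ} {bm bp : ℝ} {u : EuclideanSpace ℝ (Fin (n + 1)) → ℝ}
  {V : EuclideanSpace ℝ (Fin (n + 1)) → EuclideanSpace ℝ (Fin (n + 1))}
  {f : EuclideanSpace ℝ (Fin n) → ℝ}

/-- Integration by parts in the vertical direction. -/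
theorem integral_mul_partialDeriv_last (h : IsBottomTrace n bm bp u V f)
    {ψ : EuclideanSpace ℝ (Fin (n + 1)) → ℝ} (hψ : ContDiff ℝ 1 ψ) (hc : HasCompactSupport ψ) :
    ∫ x in strip n bm bp, u x * partialDeriv (Fin.last n) ψ x
      = - (∫ x in strip n bm bp, ψ x * V x (Fin.last n))
        + ((∫ x', ψ (withLast x' bp) * traceAt bm V f bp x')
          - ∫ x', ψ (withLast x' bm) * traceAt bm V f bm x') := by
  obtain ⟨C, hC⟩ := hc.exists_bound_of_continuous hψ.continuous
  have hdc := continuous_partialDeriv_of_contDiff_one (Fin.last n) hψ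
  have hmp := measurePreserving_withLast_restrict (n := n) (measurableSet_Ioo (a := bm) (b := bp))
  have hi1 := h.integrable_prod_mul hdc (hasCompactSupport_partialDeriv (Fin.last n) hc)
  have hi2 : Integrable (fun p : EuclideanSpace ℝ (Fin n) × ℝ =>
      ψ (withLast p.1 p.2) * lastPart V p) (volume.prod (volume.restrict (Ioo bm bp))) := by
    have h1 : Integrable (lastPart V) ((volume : Measure (EuclideanSpace ℝ (Fin n))).prod
        (volume.restrict (Ioo bm bp))) := by
      rw [← Measure.restrict_univ (μ := (volume : Measure (EuclideanSpace ℝ (Fin n)))),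
        Measure.prod_restrict]
      exact h.integrable_lastPart.restrict
    exact h1.bdd_mul (c := C) (hψ.continuous.comp continuous_withLast).aestronglyMeasurable
      (Eventually.of_forall fun p => hC _)
  have e1 : ∫ x in strip n bm bp, u x * partialDeriv (Fin.last n) ψ x
      = ∫ x', ∫ t in Ioo bm bp, u (withLast x' t) * partialDeriv (Fin.last n) ψ (withLast x' t) := by
    rw [← integral_prod _ hi1]
    exact (hmp.integral_comp (measurableEmbedding_withLast n) _).symm
  have e2 : ∫ x in strip n bm bp, ψ x * V x (Fin.last n)
      = ∫ x', ∫ t in Ioo bm bp, ψ (withLast x' t) * lastPart V (x', t) := by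
    rw [← integral_prod _ hi2]
    exact (hmp.integral_comp (measurableEmbedding_withLast n) _).symm
  have hder : ∀ (x' : EuclideanSpace ℝ (Fin n)) (t : ℝ), HasDerivAt (fun t => ψ (withLast x' t))
      (partialDeriv (Fin.last n) ψ (withLast x' t)) t := by
    intro x' t
    have h1 : HasDerivAt (fun t : ℝ => withLast x' t) (withLast 0 1) t := by
      have h2 : (fun t : ℝ => withLast x' t)
          = fun t => withLast x' 0 + t • withLast (0 : EuclideanSpace ℝ (Fin n)) 1 := by
        funext t; rw [← withLast_smul, ← withLast_add]; simp
      rw [h2]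
      simpa using ((hasDerivAt_id t).smul_const (withLast (0 : EuclideanSpace ℝ (Fin n)) 1)).const_add
        (withLast x' 0)
    have h3 := ((hψ.differentiable one_ne_zero) (withLast x' t)).hasFDerivAt.comp_hasDerivAt t h1
    rw [withLast_zero_one] at h3
    exact h3
  -- On almost every vertical line this is `integral_primitive_mul_deriv` with constant `f x'`.
  have e3 : ∀ᵐ x' : EuclideanSpace ℝ (Fin n),
      ∫ t in Ioo bm bp, u (withLast x' t) * partialDeriv (Fin.last n) ψ (withLast x' t)
        = ψ (withLast x' bp) * traceAt bm V f bp x' - ψ (withLast x' bm) * traceAt bm V f bm x'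
          - ∫ t in Ioo bm bp, ψ (withLast x' t) * lastPart V (x', t) := by
    filter_upwards [Measure.ae_ae_of_ae_prod h.rep_restrict, h.ae_integrable_lastPart]
      with x' hx hxi
    have h1 := integral_primitive_mul_deriv hxi (hder x')
      (hdc.comp (continuous_withLast.comp (by fun_prop : Continuous fun t : ℝ => (x', t))))
      (f x') bm bp
    have hI : ∀ F : ℝ → ℝ, ∫ t in Ioo bm bp, F t = ∫ t in bm..bp, F t := fun F => by
      rw [intervalIntegral.integral_of_le h.lt.le, integral_Ioc_eq_integral_Ioo]
    rw [hI fun t => ψ (withLast x' t) * lastPart V (x', t), traceAt_bottom, traceAt,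
      mul_comm (ψ _), mul_comm (ψ (withLast x' bm)), ← h1, ← hI]
    refine integral_congr_ae ?_
    filter_upwards [hx] with t ht
    rw [ht]
  have i1 := integrable_withLast_mul hψ.continuous hc bp (h.locallyIntegrable_traceAt bp)
  have i2 := integrable_withLast_mul hψ.continuous hc bm (h.locallyIntegrable_traceAt bm)
  rw [e1, e2, integral_congr_ae e3, integral_sub (f := fun x' => ψ (withLast x' bp) *
    traceAt bm V f bp x' - ψ (withLast x' bm) * traceAt bm V f bm x') (i1.sub i2)
    hi2.integral_prod_left, integral_sub i1 i2]
  ring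

end IsBottomTrace

/-! ### Horizontal translations and horizontal integration by parts -/

namespace IsStripGradient

variable {n : ℕ} {bm bp : ℝ} {u : EuclideanSpace ℝ (Fin (n + 1)) → ℝ}
  {V : EuclideanSpace ℝ (Fin (n + 1)) → EuclideanSpace ℝ (Fin (n + 1))}

/-- The strip is invariant under horizontal translations. -/
theorem ae_indicator_translate_horizontal (h : IsStripGradient n bm bp u V)
    {y : EuclideanSpace ℝ (Fin (n + 1))} (hy : y (Fin.last n) = 0) :
    ∀ᵐ x, (strip n bm bp).indicator u (x + y) - (strip n bm bp).indicator u x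
      = ∫ s in Icc (0 : ℝ) 1, inner ℝ (V (x + s • y)) y := by
  have hmem : ∀ (x : EuclideanSpace ℝ (Fin (n + 1))) (s : ℝ),
      x + s • y ∈ strip n bm bp ↔ x ∈ strip n bm bp := fun x s => by simp [strip, hy]
  have hmem1 : ∀ x, x + y ∈ strip n bm bp ↔ x ∈ strip n bm bp := fun x => by
    simpa using hmem x 1
  filter_upwards [ae_sub_eq_integral_inner h.locInt h.grad_meas h.grad_int h.grad_zero h.weak
    (isOpen_strip n bm bp) y fun x hx s _ => (hmem x s).2 hx] with x hx
  by_cases hxs : x ∈ strip n bm bp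
  · rw [indicator_of_mem hxs, indicator_of_mem ((hmem1 x).2 hxs), hx hxs]
  · rw [indicator_of_notMem hxs, indicator_of_notMem fun h' => hxs ((hmem1 x).1 h')]
    simp [fun s => h.grad_zero _ fun h' => hxs ((hmem x s).1 h')]

/-- `L¹` estimate of horizontal differences on horizontal slabs. -/
theorem lintegral_horizontal_difference_le (h : IsStripGradient n bm bp u V)
    {y : EuclideanSpace ℝ (Fin (n + 1))} (hy : y (Fin.last n) = 0) {J : Set ℝ}
    (hJ : MeasurableSet J) (hJs : J ⊆ Ioo bm bp) :
    ∫⁻ x in {x | x (Fin.last n) ∈ J}, ‖u (x + y) - u x‖ₑ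
      ≤ ‖y‖ₑ * ∫⁻ x in {x | x (Fin.last n) ∈ J}, ‖V x‖ₑ := by
  set S : Set (EuclideanSpace ℝ (Fin (n + 1))) := {x | x (Fin.last n) ∈ J} with hS
  have hSm : MeasurableSet S := measurableSet_preimage (by fun_prop) hJ
  have hSs : S ⊆ strip n bm bp := fun x hx => hJs hx
  have hVm : Measurable fun x => ‖V x‖ₑ := h.grad_meas.enorm
  have hmem : ∀ (x : EuclideanSpace ℝ (Fin (n + 1))) (s : ℝ), x + s • y ∈ S ↔ x ∈ S :=
    fun x s => by simp [hS, hy]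
  have h1 : ∀ᵐ x ∂volume.restrict S, ‖u (x + y) - u x‖ₑ
      ≤ ‖y‖ₑ * ∫⁻ s in Icc (0 : ℝ) 1, ‖V (x + s • y)‖ₑ := by
    filter_upwards [ae_restrict_of_ae (s := S) (h.ae_indicator_translate_horizontal hy),
      ae_restrict_mem hSm] with x hx hxS
    have hxy : x + y ∈ S := by simpa using (hmem x 1).2 hxS
    rw [indicator_of_mem (hSs hxS), indicator_of_mem (hSs hxy)] at hx
    have hVs : Measurable fun s : ℝ => ‖V (x + s • y)‖ₑ := hVm.comp (by fun_prop)
    rw [hx, ← lintegral_const_mul _ hVs]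
    refine (enorm_integral_le_lintegral_enorm _).trans (lintegral_mono fun s => ?_)
    rw [← enorm_norm (inner ℝ _ _), ← enorm_norm y, ← enorm_norm (V _), ← enorm_mul, mul_comm ‖y‖]
    rw [Real.enorm_of_nonneg (norm_nonneg _), Real.enorm_of_nonneg (by positivity)]
    exact ENNReal.ofReal_le_ofReal (norm_inner_le_norm _ _)
  have hVm2 : Measurable fun p : EuclideanSpace ℝ (Fin (n + 1)) × ℝ => ‖V (p.1 + p.2 • y)‖ₑ :=
    hVm.comp (by fun_prop)
  refine (lintegral_mono_ae h1).trans ?_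
  rw [lintegral_const_mul _ hVm2.lintegral_prod_right']
  refine mul_le_mul' le_rfl (le_of_eq ?_)
  refine (lintegral_lintegral_swap (f := fun x (s : ℝ) => ‖V (x + s • y)‖ₑ)
    hVm2.aemeasurable).trans ?_
  -- The slab is invariant under multiples of `y`, so every translate has the same integral over it.
  have h2 : ∀ s : ℝ, ∫⁻ x in S, ‖V (x + s • y)‖ₑ = ∫⁻ x in S, ‖V x‖ₑ := by
    intro s
    rw [← lintegral_indicator hSm, ← lintegral_indicator hSm,
      ← lintegral_add_right_eq_self (S.indicator fun x => ‖V x‖ₑ) (s • y)]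
    refine lintegral_congr fun x => ?_
    by_cases hx : x ∈ S
    · rw [indicator_of_mem hx, indicator_of_mem ((hmem x s).2 hx)]
    · rw [indicator_of_notMem hx, indicator_of_notMem fun h' => hx ((hmem x s).1 h')]
  simp [h2]

end IsStripGradient

namespace IsBottomTrace

variable {n : ℕ} {bm bp : ℝ} {u : EuclideanSpace ℝ (Fin (n + 1)) → ℝ}
  {V : EuclideanSpace ℝ (Fin (n + 1)) → EuclideanSpace ℝ (Fin (n + 1))}
  {f : EuclideanSpace ℝ (Fin n) → ℝ}

/-- Integration by parts in a horizontal direction `y`. -/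
theorem integral_mul_fderiv_horizontal (h : IsBottomTrace n bm bp u V f)
    {y : EuclideanSpace ℝ (Fin (n + 1))} (hy : y (Fin.last n) = 0)
    {ψ : EuclideanSpace ℝ (Fin (n + 1)) → ℝ} (hψ : ContDiff ℝ 1 ψ) (hc : HasCompactSupport ψ) :
    ∫ x in strip n bm bp, u x * fderiv ℝ ψ x y
      = - ∫ x in strip n bm bp, ψ x * inner ℝ (V x) y := by
  set v := (strip n bm bp).indicator u with hv
  set G : EuclideanSpace ℝ (Fin (n + 1)) → ℝ := fun x => inner ℝ (V x) y with hG
  have hSm : MeasurableSet (strip n bm bp) := (isOpen_strip n bm bp).measurableSet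
  have hvm : StronglyMeasurable v := h.meas.indicator hSm
  have hGm : StronglyMeasurable G := h.grad_meas.inner stronglyMeasurable_const
  have hGi : Integrable G := h.grad_int.inner_const y
  have hvi : ∀ {θ : EuclideanSpace ℝ (Fin (n + 1)) → ℝ}, Continuous θ → HasCompactSupport θ →
      Integrable fun x => v x * θ x := by
    intro θ h1 h2
    refine ((integrable_indicator_iff hSm).2 (h.integrableOn_mul h1 h2)).congr
      (Eventually.of_forall fun x => ?_)
    by_cases hx : x ∈ strip n bm bp <;> simp [hv, hx]
  obtain ⟨C, hC⟩ := hc.exists_bound_of_continuous hψ.continuous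
  have hdc : Continuous fun x => fderiv ℝ ψ x y :=
    (hψ.continuous_fderiv one_ne_zero).clm_apply continuous_const
  obtain ⟨C', hC'⟩ := (hc.fderiv_apply ℝ y).exists_bound_of_continuous hdc
  have hcτ : ∀ τ : ℝ, HasCompactSupport fun x => ψ (x - τ • y) := fun τ =>
    hc.comp_homeomorph (Homeomorph.subRight (τ • y))
  -- The derivative of `N` at `0` is computed twice: under the integral it falls on `ψ`; with the
  -- translation moved onto `u`, `N - N 0` is the primitive of `M`. No cut-off of `ψ` near the faces
  -- is needed, since horizontal translations preserve the strip.
  set N : ℝ → ℝ := fun τ => ∫ x, v x * ψ (x - τ • y) with hN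
  set M : ℝ → ℝ := fun τ => ∫ x, ψ (x - τ • y) * G x with hM
  have hN' : HasDerivAt N (∫ x, v x * -(fderiv ℝ ψ x y)) 0 := by
    set K : Set (EuclideanSpace ℝ (Fin (n + 1))) :=
      (fun p : EuclideanSpace ℝ (Fin (n + 1)) × ℝ => p.1 + p.2 • y) ''
        (tsupport ψ ×ˢ Icc (-1 : ℝ) 1) with hKdef
    have hKc : IsCompact K := (IsCompact.prod hc isCompact_Icc).image (by fun_prop)
    -- The function `v` itself need not be integrable. A cut-off equal to `1` on `K`, which contains
    -- the supports of the translates with `|τ| ≤ 1`, gives the dominating function.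
    obtain ⟨θ, hθ1, -, hθ0, -⟩ :=
      exists_continuous_one_zero_of_isCompact hKc isClosed_empty (disjoint_empty K)
    have hb : Integrable fun x => ‖v x * θ x‖ * C' := (hvi θ.continuous hθ0).norm.mul_const _
    have := (hasDerivAt_integral_of_dominated_loc_of_deriv_le (μ := volume) (x₀ := (0 : ℝ))
      (F := fun τ x => v x * ψ (x - τ • y)) (F' := fun τ x => v x * -(fderiv ℝ ψ (x - τ • y) y))
      (bound := fun x => ‖v x * θ x‖ * C') (s := Ioo (-1) 1) (Ioo_mem_nhds (by norm_num) (by norm_num))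
      (Eventually.of_forall fun τ => (hvi (hψ.continuous.comp (by fun_prop)) (hcτ τ)).1)
      (hvi (hψ.continuous.comp (by fun_prop)) (hcτ 0))
      (hvm.aestronglyMeasurable.mul ((hdc.comp (by fun_prop)).neg).aestronglyMeasurable)
      (Eventually.of_forall fun x τ hτ => ?_) hb (Eventually.of_forall fun x τ hτ => ?_)).2
    · simpa using this
    · by_cases hx : x ∈ K
      · rw [norm_mul, norm_neg, hθ1 hx]
        simp only [Pi.one_apply, mul_one]
        exact mul_le_mul_of_nonneg_left (hC' _) (norm_nonneg _)
      · have h0 : fderiv ℝ ψ (x - τ • y) = 0 := by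
          refine image_eq_zero_of_notMem_tsupport fun hx' => hx ?_
          exact ⟨(x - τ • y, τ), ⟨tsupport_fderiv_subset ℝ hx', hτ.1.le, hτ.2.le⟩, by simp⟩
        rw [h0]
        simpa using mul_nonneg (norm_nonneg (v x * θ x)) ((norm_nonneg _).trans (hC' 0))
    · have h1 : HasDerivAt (fun s : ℝ => x - s • y) (-y) τ := by
        simpa using ((hasDerivAt_id τ).smul_const y).const_sub x
      have h2 := ((hψ.differentiable one_ne_zero) (x - τ • y)).hasFDerivAt.comp_hasDerivAt τ h1
      exact (h2.congr_deriv (by simp)).const_mul _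
  have hMc : Continuous M := by
    refine continuous_of_dominated (bound := fun x => C * ‖G x‖) (fun τ => ?_) (fun τ => ?_)
      (hGi.norm.const_mul C) (Eventually.of_forall fun x => ?_)
    · exact ((hψ.continuous.comp (by fun_prop)).aestronglyMeasurable).mul hGm.aestronglyMeasurable
    · refine Eventually.of_forall fun x => ?_
      rw [norm_mul]
      exact mul_le_mul_of_nonneg_right (hC _) (norm_nonneg _)
    · exact (hψ.continuous.comp (by fun_prop)).mul continuous_const
  have hNM : ∀ τ, N τ - N 0 = ∫ s in (0 : ℝ)..τ, M s := by
    intro τ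
    have hτy : (τ • y) (Fin.last n) = 0 := by simp [hy]
    have key := h.ae_indicator_translate_horizontal hτy
    have hGp := integrable_comp_add_smul (μ := volume) hGm hGi (τ • y)
      (volume.restrict (Icc (0 : ℝ) 1))
    have hI : Integrable (fun p : EuclideanSpace ℝ (Fin (n + 1)) × ℝ =>
        ψ p.1 * G (p.1 + p.2 • τ • y)) (volume.prod (volume.restrict (Icc (0 : ℝ) 1))) :=
      hGp.bdd_mul (c := C) (hψ.continuous.comp continuous_fst).aestronglyMeasurable
        (Eventually.of_forall fun p => hC p.1)
    have e1 : N τ = ∫ x, v (x + τ • y) * ψ x := by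
      simp only [hN]
      rw [← integral_add_right_eq_self (fun x => v x * ψ (x - τ • y)) (τ • y)]
      simp
    have i1 : Integrable fun x => v (x + τ • y) * ψ x := by
      have := (hvi (hψ.continuous.comp (by fun_prop)) (hcτ τ)).comp_add_right (τ • y)
      simpa using this
    have e2 : N 0 = ∫ x, v x * ψ x := by simp [hN]
    rw [e1, e2, ← integral_sub i1 (hvi hψ.continuous hc)]
    have e3 : ∫ x, (v (x + τ • y) * ψ x - v x * ψ x)
        = ∫ x, τ * ∫ s in Icc (0 : ℝ) 1, ψ x * G (x + s • τ • y) := by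
      refine integral_congr_ae ?_
      filter_upwards [key] with x hx
      rw [← sub_mul, hx, integral_const_mul]
      simp_rw [inner_smul_right]
      rw [integral_const_mul]
      ring
    rw [e3, integral_const_mul, integral_integral_swap hI]
    have e4 : ∀ s : ℝ, ∫ x, ψ x * G (x + s • τ • y) = M (0 + τ * s) := by
      intro s
      rw [hM]
      simp only
      rw [← integral_add_right_eq_self (fun x => ψ (x - (0 + τ * s) • y) * G x) (s • τ • y)]
      simp [smul_smul, mul_comm]
    simp_rw [e4]
    rw [integral_Icc_eq_integral_Ioc, ← intervalIntegral.integral_of_le zero_le_one,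
      intervalIntegral.mul_integral_comp_add_mul (f := M)]
    simp
  have hN2 : HasDerivAt N (M 0) 0 := by
    have h1 := (hMc.integral_hasStrictDerivAt 0 0).hasDerivAt.const_add (N 0)
    refine h1.congr_of_eventuallyEq (Eventually.of_forall fun τ => ?_)
    simp only
    rw [← hNM]; ring
  have hfin := hN'.unique hN2
  have e5 : ∫ x in strip n bm bp, u x * fderiv ℝ ψ x y = ∫ x, v x * fderiv ℝ ψ x y := by
    rw [← integral_indicator hSm]
    congr 1; funext x
    by_cases hx : x ∈ strip n bm bp <;> simp [hv, hx]
  have e6 : ∫ x in strip n bm bp, ψ x * G x = ∫ x, ψ x * G x :=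
    setIntegral_eq_integral_of_forall_compl_eq_zero fun x hx => by simp [hG, h.grad_zero x hx]
  rw [e5, e6]
  simp only [mul_neg, integral_neg] at hfin
  simp only [hM, zero_smul, sub_zero] at hfin
  linarith

end IsBottomTrace

/-! ### The modulus of continuity of a trace -/

namespace IsBottomTrace

variable {n : ℕ} {bm bp : ℝ} {u : EuclideanSpace ℝ (Fin (n + 1)) → ℝ}
  {V : EuclideanSpace ℝ (Fin (n + 1)) → EuclideanSpace ℝ (Fin (n + 1))}
  {f : EuclideanSpace ℝ (Fin n) → ℝ}

theorem rep_restrict_Ioo (h : IsBottomTrace n bm bp u V f) {a₁ a₂ : ℝ}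
    (hJ : Ioo a₁ a₂ ⊆ Ioo bm bp) :
    ∀ᵐ x' : EuclideanSpace ℝ (Fin n), ∀ᵐ t ∂volume.restrict (Ioo a₁ a₂),
      u (withLast x' t) = traceAt bm V f t x' := by
  filter_upwards [Measure.ae_ae_of_ae_prod h.rep_restrict] with x' hx
  exact ae_restrict_of_ae_restrict_of_subset hJ hx

/-- The `L¹` modulus of continuity of a trace is controlled by the gradient on a slab of width at
least the size of the translation, whose closure contains the given height. -/
theorem lintegral_traceAt_translate_le (h : IsBottomTrace n bm bp u V f) {a₁ a₂ b : ℝ}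
    (ha : a₁ < a₂) (hJ : Ioo a₁ a₂ ⊆ Ioo bm bp) (hb : b ∈ Icc a₁ a₂)
    {y : EuclideanSpace ℝ (Fin n)} (hy : ‖y‖ ≤ a₂ - a₁) :
    ∫⁻ x', ‖traceAt bm V f b (x' + y) - traceAt bm V f b x'‖ₑ
      ≤ 3 * ∫⁻ x in {x | x (Fin.last n) ∈ Ioo a₁ a₂}, ‖V x‖ₑ := by
  set J := Ioo a₁ a₂ with hJdef
  set B := ∫⁻ x in {x | x (Fin.last n) ∈ J}, ‖V x‖ₑ with hB
  set D : EuclideanSpace ℝ (Fin n) → ℝ≥0∞ := fun x' =>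
    ∫⁻ r in J, ‖V (withLast x' r) (Fin.last n)‖ₑ with hD
  have hDm : Measurable D :=
    (h.measurable_lastPart.comp continuous_withLast.measurable).lintegral_prod_right'
  have hDB : ∫⁻ x', D x' ≤ B := by
    rw [hD, ← lintegral_strip_eq measurableSet_Ioo h.measurable_lastPart]
    refine lintegral_mono fun x => ?_
    rw [← enorm_norm (V x), ← enorm_norm (V x _), Real.enorm_of_nonneg (norm_nonneg _),
      Real.enorm_of_nonneg (norm_nonneg _)]
    exact ENNReal.ofReal_le_ofReal (PiLp.norm_apply_le _ _)
  have hum : Measurable fun x => ‖u (x + withLast y 0) - u x‖ₑ :=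
    ((h.meas.comp_measurable (by fun_prop)).sub h.meas).enorm
  set H : EuclideanSpace ℝ (Fin n) → ℝ≥0∞ := fun x' =>
    ∫⁻ t in J, ‖u (withLast x' t + withLast y 0) - u (withLast x' t)‖ₑ with hH
  have hHm : Measurable H := (hum.comp continuous_withLast.measurable).lintegral_prod_right'
  have hvol : volume J = ENNReal.ofReal (a₂ - a₁) := Real.volume_Ioo
  -- The horizontal differences cost `‖y‖ * B`, and `‖y‖` is at most the width of the slab.
  have hHB : ∫⁻ x', H x' ≤ volume J * B := by
    rw [hH, ← lintegral_strip_eq measurableSet_Ioo hum]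
    refine (h.lintegral_horizontal_difference_le (by simp) measurableSet_Ioo hJ).trans ?_
    gcongr
    rw [← enorm_norm, norm_withLast_zero, Real.enorm_of_nonneg (norm_nonneg _), hvol]
    exact ENNReal.ofReal_le_ofReal hy
  have htr : MeasurePreserving (fun x' : EuclideanSpace ℝ (Fin n) => x' + y) :=
    measurePreserving_add_right volume y
  -- Pass through height `t` at both `x'` and `x' + y`, then integrate over `t ∈ J`. The vertical
  -- terms are bounded independently of `t`, whence the factors `volume J`.
  have key : ∀ᵐ x' : EuclideanSpace ℝ (Fin n),
      ‖traceAt bm V f b (x' + y) - traceAt bm V f b x'‖ₑ * volume J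
        ≤ D (x' + y) * volume J + H x' + D x' * volume J := by
    filter_upwards [h.rep_restrict_Ioo hJ, htr.quasiMeasurePreserving.ae (h.rep_restrict_Ioo hJ),
      h.ae_integrable_lastPart, htr.quasiMeasurePreserving.ae h.ae_integrable_lastPart]
      with x' hx hxy hi hiy
    have hHm' : Measurable fun t : ℝ => ‖u (withLast x' t + withLast y 0) - u (withLast x' t)‖ₑ :=
      hum.comp (continuous_withLast.comp (by fun_prop : Continuous fun t : ℝ => (x', t))).measurable
    rw [← setLIntegral_const, ← setLIntegral_const, ← setLIntegral_const, hH,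
      ← lintegral_add_left measurable_const, ← lintegral_add_right _ measurable_const]
    refine lintegral_mono_ae ?_
    filter_upwards [hx, hxy, ae_restrict_mem measurableSet_Ioo] with t ht hty htJ
    have e : withLast x' t + withLast y 0 = withLast (x' + y) t := by
      rw [← withLast_add, add_zero]
    rw [e, ht, hty]
    have h1 := enorm_traceAt_sub_le (bm := bm) (f := f) (x' + y) hiy (Ioo_subset_Icc_self htJ) hb
    have h2 := enorm_traceAt_sub_le (bm := bm) (f := f) x' hi hb (Ioo_subset_Icc_self htJ)
    have e2 : traceAt bm V f b (x' + y) - traceAt bm V f b x'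
        = (traceAt bm V f b (x' + y) - traceAt bm V f t (x' + y))
          + (traceAt bm V f t (x' + y) - traceAt bm V f t x')
          + (traceAt bm V f t x' - traceAt bm V f b x') := by ring
    rw [e2]
    exact (enorm_add_le _ _).trans (add_le_add ((enorm_add_le _ _).trans (add_le_add h1 le_rfl)) h2)
  have hJ0 : volume J ≠ 0 := by rw [hvol]; simpa using ha
  have hJt : volume J ≠ ⊤ := by rw [hvol]; exact ENNReal.ofReal_ne_top
  have hfin : (∫⁻ x', ‖traceAt bm V f b (x' + y) - traceAt bm V f b x'‖ₑ) * volume J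
      ≤ (3 * B) * volume J := by
    rw [← lintegral_mul_const' _ _ hJt]
    refine (lintegral_mono_ae key).trans ?_
    rw [lintegral_add_right _ (hDm.mul_const _), lintegral_add_right _ hHm,
      lintegral_mul_const' _ _ hJt, lintegral_mul_const' _ _ hJt, htr.lintegral_comp hDm]
    -- Two vertical terms and one horizontal term give the `3`; the common factor `volume J` is
    -- finite and nonzero and cancels.
    calc _ ≤ B * volume J + volume J * B + B * volume J := by gcongr
      _ = (3 * B) * volume J := by ring
  exact (ENNReal.mul_le_mul_iff_left hJ0 hJt).1 hfin

end IsBottomTrace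

/-! ### From Sobolev classes to representatives -/

theorem HasWeakPartial.congr_right {d : ℕ} {Ω : Set (EuclideanSpace ℝ (Fin d))} {i : Fin d}
    {u g k : EuclideanSpace ℝ (Fin d) → ℝ} (h : HasWeakPartial Ω i u g)
    (hgk : g =ᵐ[volume.restrict Ω] k) : HasWeakPartial Ω i u k := by
  intro φ h1 h2 h3
  rw [h φ h1 h2 h3]
  congr 1
  refine integral_congr_ae ?_
  filter_upwards [hgk] with x hx
  rw [hx]

/-- Weak partial derivatives are unique almost everywhere. -/
theorem HasWeakPartial.ae_eq {d : ℕ} {Ω : Set (EuclideanSpace ℝ (Fin d))} (hΩ : IsOpen Ω)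
    {i : Fin d} {u g k : EuclideanSpace ℝ (Fin d) → ℝ} (hg : HasWeakPartial Ω i u g)
    (hk : HasWeakPartial Ω i u k) (hgi : IntegrableOn g Ω) (hki : IntegrableOn k Ω) :
    g =ᵐ[volume.restrict Ω] k := by
  have h := hΩ.ae_eq_zero_of_integral_contDiff_smul_eq_zero
    (hgi.sub hki).locallyIntegrableOn (fun φ h1 h2 h3 => ?_)
  · refine (ae_restrict_iff' hΩ.measurableSet).2 ?_
    filter_upwards [h] with x hx hxΩ
    exact sub_eq_zero.1 (hx hxΩ)
  · have e : ∫ x, φ x • (g - k) x = ∫ x in Ω, (g x * φ x - k x * φ x) := by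
      rw [setIntegral_eq_integral_of_forall_compl_eq_zero]
      · refine integral_congr_ae (Eventually.of_forall fun x => ?_)
        simp only [Pi.sub_apply, smul_eq_mul]; ring
      · intro x hx
        simp [image_eq_zero_of_notMem_tsupport fun h' => hx (h3 h')]
    rw [e, integral_sub
      (integrableOn_mul_of_compact hgi.locallyIntegrableOn h1.continuous h2 h3)
      (integrableOn_mul_of_compact hki.locallyIntegrableOn h1.continuous h2 h3)]
    have := (hg φ h1 h2 h3).symm.trans (hk φ h1 h2 h3)
    linarith

theorem sobolevRep_smul_add {d : ℕ} {Ω : Set (EuclideanSpace ℝ (Fin d))} (a : ℝ)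
    (u v : HomSobolev Ω) :
    sobolevRep (a • u + v) =ᵐ[volume.restrict Ω] fun x => a * sobolevRep u x + sobolevRep v x := by
  have h1 := AEEqFun.coeFn_add
    (a • (u : EuclideanSpace ℝ (Fin d) →ₘ[volume.restrict Ω] ℝ)) v
  have h2 := AEEqFun.coeFn_smul a (u : EuclideanSpace ℝ (Fin d) →ₘ[volume.restrict Ω] ℝ)
  filter_upwards [h1, h2] with x h1 h2
  simp only [sobolevRep, Submodule.coe_add, Submodule.coe_smul]
  rw [h1, Pi.add_apply, h2, Pi.smul_apply, smul_eq_mul]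

theorem weakPartial_smul_add {d : ℕ} {Ω : Set (EuclideanSpace ℝ (Fin d))} (hΩ : IsOpen Ω) (a : ℝ)
    (u v : HomSobolev Ω) (i : Fin d) :
    weakPartial (a • u + v) i =ᵐ[volume.restrict Ω]
      fun x => a * weakPartial u i x + weakPartial v i x := by
  have hu := integrableOn_weakPartial u i
  have hv := integrableOn_weakPartial v i
  have hul : LocallyIntegrableOn (sobolevRep u) Ω := u.2.1
  have hvl : LocallyIntegrableOn (sobolevRep v) Ω := v.2.1
  refine (hasWeakPartial_weakPartial (a • u + v) i).ae_eq hΩ ?_ (integrableOn_weakPartial _ i)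
    ((hu.const_mul a).add hv)
  intro φ h1 h2 h3
  have e1 : ∫ x in Ω, sobolevRep (a • u + v) x * partialDeriv i φ x
      = ∫ x in Ω, (a * (sobolevRep u x * partialDeriv i φ x)
        + sobolevRep v x * partialDeriv i φ x) := by
    refine integral_congr_ae ?_
    filter_upwards [sobolevRep_smul_add a u v] with x hx
    rw [hx]; ring
  have e2 : ∫ x in Ω, (a * weakPartial u i x + weakPartial v i x) * φ x
      = ∫ x in Ω, (a * (weakPartial u i x * φ x) + weakPartial v i x * φ x) := by
    congr 1; funext x; ring
  refine e1.trans ?_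
  rw [e2, integral_add ((integrableOn_mul_partialDeriv i hul h1 h2 h3).const_mul a)
    (integrableOn_mul_partialDeriv i hvl h1 h2 h3),
    integral_add ((integrableOn_mul_of_compact hu.locallyIntegrableOn h1.continuous h2 h3).const_mul
      a) (integrableOn_mul_of_compact hv.locallyIntegrableOn h1.continuous h2 h3),
    integral_const_mul, integral_const_mul]
  have e3 := hasWeakPartial_weakPartial u i φ h1 h2 h3
  have e4 := hasWeakPartial_weakPartial v i φ h1 h2 h3
  change ∫ x in Ω, sobolevRep u x * partialDeriv i φ x = _ at e3
  change ∫ x in Ω, sobolevRep v x * partialDeriv i φ x = _ at e4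
  rw [e3, e4]
  ring

theorem integrableOn_weakGradient {d : ℕ} {Ω : Set (EuclideanSpace ℝ (Fin d))}
    (u : HomSobolev Ω) : IntegrableOn (weakGradient u) Ω :=
  Integrable.of_eval_piLp fun i => integrableOn_weakPartial u i

/-- The trace data attached to a function in the homogeneous Sobolev space of a strip. -/
theorem exists_isBottomTrace {n : ℕ} {bm bp : ℝ} (hb : bm < bp) (u : HomSobolev (strip n bm bp)) :
    ∃ V f, IsBottomTrace n bm bp (sobolevRep u) V f ∧
      V =ᵐ[volume.restrict (strip n bm bp)] weakGradient u := by
  have hS := (isOpen_strip n bm bp).measurableSet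
  have hi := integrableOn_weakGradient u
  -- The chosen weak gradient is only a.e. measurable on the strip; a measurable version extended by
  -- zero is needed for translations and Fubini.
  set V := (strip n bm bp).indicator (hi.aestronglyMeasurable.mk (weakGradient u)) with hV
  have hVae : V =ᵐ[volume.restrict (strip n bm bp)] weakGradient u :=
    (indicator_ae_eq_restrict hS).trans hi.aestronglyMeasurable.ae_eq_mk.symm
  have h : IsStripGradient n bm bp (sobolevRep u) V :=
    { lt := hb
      meas := AEEqFun.stronglyMeasurable _
      locInt := u.2.1
      grad_meas := hi.aestronglyMeasurable.stronglyMeasurable_mk.indicator hS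
      grad_int := (integrable_indicator_iff hS).2 (hi.congr hi.aestronglyMeasurable.ae_eq_mk)
      grad_zero := fun x hx => indicator_of_notMem hx _
      weak := fun i => (hasWeakPartial_weakPartial u i).congr_right (by
        filter_upwards [hVae] with x hx
        rw [hx, weakGradient]) }
  obtain ⟨f, hf, hrep⟩ := h.exists_vertical_representation
  exact ⟨V, f, { h with trace_meas := hf, rep := hrep }, hVae⟩

/-- The function on the boundary of the strip with given values on the two faces. -/
theorem exists_locL1Boundary {n : ℕ} {bm bp : ℝ} (hb : bm < bp)
    {f₁ f₂ : EuclideanSpace ℝ (Fin n) → ℝ} (h₁ : LocallyIntegrable f₁)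
    (h₂ : LocallyIntegrable f₂) :
    ∃ T : LocL1Boundary (strip n bm bp), (∀ᵐ x', boundaryRep T (withLast x' bm) = f₁ x') ∧
      ∀ᵐ x', boundaryRep T (withLast x' bp) = f₂ x' := by
  set F : EuclideanSpace ℝ (Fin (n + 1)) → ℝ := fun x =>
    if x (Fin.last n) = bp then f₂ ((withLastL n).symm x).1 else f₁ ((withLastL n).symm x).1 with hF
  have e : ∀ (x' : EuclideanSpace ℝ (Fin n)) (b : ℝ), ((withLastL n).symm (withLast x' b)).1 = x' :=
    fun x' b => congrArg Prod.fst ((withLastL n).symm_apply_apply (x', b))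
  have e1 : ∀ x' : EuclideanSpace ℝ (Fin n), F (withLast x' bm) = f₁ x' := fun x' => by
    simp [hF, e, hb.ne]
  have e2 : ∀ x' : EuclideanSpace ℝ (Fin n), F (withLast x' bp) = f₂ x' := fun x' => by
    simp [hF, e]
  have hFl : LocallyIntegrable F (surfaceMeasure (strip n bm bp)) :=
    locallyIntegrable_surfaceMeasure_strip hb (by simpa only [e1] using h₁)
      (by simpa only [e2] using h₂)
  have hFae := AEEqFun.coeFn_mk F hFl.aestronglyMeasurable
  refine ⟨⟨AEEqFun.mk F hFl.aestronglyMeasurable, hFl.congr hFae.symm⟩, ?_⟩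
  have := (ae_surfaceMeasure_strip_iff hb).1 hFae
  refine ⟨?_, ?_⟩
  · filter_upwards [this.1] with x' hx
    exact hx.trans (e1 x')
  · filter_upwards [this.2] with x' hx
    exact hx.trans (e2 x')

/-! ### Boundary classes and the properties of the trace -/

/-- `T` is the trace of `u`. -/
structure IsTraceOf (n : ℕ) (bm bp : ℝ) (u : HomSobolev (strip n bm bp))
    (V : EuclideanSpace ℝ (Fin (n + 1)) → EuclideanSpace ℝ (Fin (n + 1)))
    (f : EuclideanSpace ℝ (Fin n) → ℝ) (T : LocL1Boundary (strip n bm bp)) : Prop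
    extends IsBottomTrace n bm bp (sobolevRep u) V f where
  grad_ae : V =ᵐ[volume.restrict (strip n bm bp)] weakGradient u
  face : ∀ b ∈ ({bm, bp} : Set ℝ), ∀ᵐ x', boundaryRep T (withLast x' b) = traceAt bm V f b x'

theorem exists_isTraceOf {n : ℕ} {bm bp : ℝ} (hb : bm < bp) (u : HomSobolev (strip n bm bp)) :
    ∃ T V f, IsTraceOf n bm bp u V f T := by
  obtain ⟨V, f, h, hV⟩ := exists_isBottomTrace hb u
  obtain ⟨T, hT1, hT2⟩ := exists_locL1Boundary hb (h.locallyIntegrable_traceAt bm)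
    (h.locallyIntegrable_traceAt bp)
  refine ⟨T, V, f, { h with grad_ae := hV, face := ?_ }⟩
  rintro b (rfl | rfl)
  exacts [hT1, hT2]

theorem measurable_stripNormal {n : ℕ} (bp : ℝ) (i : Fin (n + 1)) :
    Measurable (stripNormal bp i : EuclideanSpace ℝ (Fin (n + 1)) → ℝ) := by
  unfold stripNormal
  by_cases h : i = Fin.last n
  · simp only [h, if_true]
    exact Measurable.ite (measurableSet_eq_fun (by fun_prop) (by fun_prop)) measurable_const
      measurable_const
  · simp only [h, if_false]
    exact measurable_const

theorem norm_stripNormal_le {n : ℕ} (bp : ℝ) (i : Fin (n + 1))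
    (x : EuclideanSpace ℝ (Fin (n + 1))) : ‖stripNormal bp i x‖ ≤ 1 := by
  unfold stripNormal
  split_ifs <;> simp

theorem integrable_mul_boundaryRep_mul_stripNormal {n : ℕ} {bm bp : ℝ}
    (T : LocL1Boundary (strip n bm bp)) {ψ : EuclideanSpace ℝ (Fin (n + 1)) → ℝ}
    (hψ : Continuous ψ) (hc : HasCompactSupport ψ) (i : Fin (n + 1)) :
    Integrable (fun x => ψ x * boundaryRep T x * stripNormal bp i x)
      (surfaceMeasure (strip n bm bp)) := by
  have hT : LocallyIntegrable (boundaryRep T) (surfaceMeasure (strip n bm bp)) := T.2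
  exact (hT.integrable_smul_left_of_hasCompactSupport hψ hc).mul_bdd (c := 1)
    (measurable_stripNormal bp i).aestronglyMeasurable
    (Eventually.of_forall fun x => norm_stripNormal_le bp i x)

/-- A locally integrable function on the boundary is determined by its flux pairings. -/
theorem LocL1Boundary.ext_of_integral_eq {n : ℕ} {bm bp : ℝ}
    {T S : LocL1Boundary (strip n bm bp)}
    (h : ∀ ψ : EuclideanSpace ℝ (Fin (n + 1)) → ℝ, ContDiff ℝ 1 ψ → HasCompactSupport ψ →
      ∫ x, ψ x * boundaryRep T x * stripNormal bp (Fin.last n) x ∂(surfaceMeasure (strip n bm bp))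
        = ∫ x, ψ x * boundaryRep S x * stripNormal bp (Fin.last n) x
          ∂(surfaceMeasure (strip n bm bp))) : T = S := by
  have hloc : ∀ R : LocL1Boundary (strip n bm bp),
      LocallyIntegrable (fun x => boundaryRep R x * stripNormal bp (Fin.last n) x)
        (surfaceMeasure (strip n bm bp)) := by
    intro R
    have hR : LocallyIntegrable (boundaryRep R) (surfaceMeasure (strip n bm bp)) := R.2
    refine hR.mono (hR.aestronglyMeasurable.mul
      (measurable_stripNormal bp (Fin.last n)).aestronglyMeasurable)
      (Eventually.of_forall fun x => ?_)
    rw [norm_mul]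
    exact mul_le_of_le_one_right (norm_nonneg _) (norm_stripNormal_le bp _ x)
  -- Smooth compactly supported functions are among the tests, and they separate locally integrable
  -- functions for the surface measure.
  have key := ae_eq_of_integral_contDiff_smul_eq (hloc T) (hloc S) fun ψ h1 h2 => by
    simpa only [smul_eq_mul, mul_assoc] using h ψ (h1.of_le (by simp)) h2
  refine Subtype.ext (AEEqFun.ext ?_)
  filter_upwards [key] with x hx
  -- The last component of the normal is `1` or `-1`, so it can be cancelled.
  refine mul_right_cancel₀ (b := stripNormal bp (Fin.last n) x) ?_ hx
  unfold stripNormal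
  split_ifs <;> simp_all

/-- An integrable function has small mass near the boundary of the strip. -/
theorem tendsto_lintegral_stripCollar {n : ℕ} {bm bp : ℝ} (hb : bm < bp)
    {G : EuclideanSpace ℝ (Fin (n + 1)) → ℝ≥0∞}
    (hG : AEMeasurable G (volume.restrict (strip n bm bp)))
    (hG' : ∫⁻ x in strip n bm bp, G x ≠ ⊤) :
    Tendsto (fun ε => ∫⁻ x in stripCollar n bm bp ε, G x) (𝓝[>] 0) (𝓝 0) := by
  have hS := (isOpen_strip n bm bp).measurableSet
  have hcm : ∀ ε, MeasurableSet (stripCollar n bm bp ε) := fun ε =>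
    measurableSet_preimage (f := fun x : EuclideanSpace ℝ (Fin (n + 1)) => x (Fin.last n))
      (by fun_prop) (measurableSet_Ioo.union measurableSet_Ioo)
  have hsub : ∀ ε, ε < bp - bm → stripCollar n bm bp ε ⊆ strip n bm bp := by
    rintro ε hε x (⟨h1, h2⟩ | ⟨h1, h2⟩)
    · exact ⟨h1, by linarith⟩
    · exact ⟨by linarith, h2⟩
  have hlim : Tendsto (fun ε => ∫⁻ x in strip n bm bp, (stripCollar n bm bp ε).indicator G x)
      (𝓝[>] 0) (𝓝 (∫⁻ _ in strip n bm bp, 0)) := by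
    refine tendsto_lintegral_filter_of_dominated_convergence' G
      (Eventually.of_forall fun ε => hG.indicator (hcm ε))
      (Eventually.of_forall fun ε => Eventually.of_forall fun x => indicator_le_self _ _ _) hG' ?_
    filter_upwards [ae_restrict_mem hS] with x hx
    -- A point of the open strip leaves the collar once `ε` is below its distance to both faces.
    refine tendsto_const_nhds.congr' ?_
    have h1 : ∀ᶠ ε in 𝓝[>] (0 : ℝ), ε < x (Fin.last n) - bm :=
      nhdsWithin_le_nhds (Iio_mem_nhds (sub_pos.2 hx.1))
    have h2 : ∀ᶠ ε in 𝓝[>] (0 : ℝ), ε < bp - x (Fin.last n) :=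
      nhdsWithin_le_nhds (Iio_mem_nhds (sub_pos.2 hx.2))
    filter_upwards [h1, h2] with ε h1 h2
    rw [indicator_of_notMem]
    rintro (⟨h3, h4⟩ | ⟨h3, h4⟩) <;> linarith
  rw [lintegral_zero] at hlim
  refine hlim.congr' ?_
  have h1 : ∀ᶠ ε in 𝓝[>] (0 : ℝ), ε < bp - bm :=
    nhdsWithin_le_nhds (Iio_mem_nhds (sub_pos.2 hb))
  filter_upwards [h1] with ε hε
  rw [lintegral_indicator (hcm ε), Measure.restrict_restrict (hcm ε),
    inter_eq_left.2 (hsub ε hε)]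

namespace IsTraceOf

variable {n : ℕ} {bm bp : ℝ} {u : HomSobolev (strip n bm bp)}
  {V : EuclideanSpace ℝ (Fin (n + 1)) → EuclideanSpace ℝ (Fin (n + 1))}
  {f : EuclideanSpace ℝ (Fin n) → ℝ} {T : LocL1Boundary (strip n bm bp)}

theorem grad_apply_ae (h : IsTraceOf n bm bp u V f T) (i : Fin (n + 1)) :
    ∀ᵐ x ∂volume.restrict (strip n bm bp), V x i = weakPartial u i x := by
  filter_upwards [h.grad_ae] with x hx
  rw [hx, weakGradient]

theorem face_bottom (h : IsTraceOf n bm bp u V f T) :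
    ∀ᵐ x', boundaryRep T (withLast x' bm) = traceAt bm V f bm x' := h.face bm (by simp)

theorem face_top (h : IsTraceOf n bm bp u V f T) :
    ∀ᵐ x', boundaryRep T (withLast x' bp) = traceAt bm V f bp x' := h.face bp (by simp)

theorem ae_eq_of_continuousOn (h : IsTraceOf n bm bp u V f T)
    {v : EuclideanSpace ℝ (Fin (n + 1)) → ℝ} (hv : ContinuousOn v (closure (strip n bm bp)))
    (huv : sobolevRep u =ᵐ[volume.restrict (strip n bm bp)] v) :
    boundaryRep T =ᵐ[surfaceMeasure (strip n bm bp)] v := by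
  have key := h.traceAt_ae_eq_of_continuousOn hv huv
  refine (ae_surfaceMeasure_strip_iff h.lt).2 ⟨?_, ?_⟩
  · filter_upwards [key, h.face_bottom] with x' h1 h2
    rw [h2, h1 bm (left_mem_Icc.2 h.lt.le)]
  · filter_upwards [key, h.face_top] with x' h1 h2
    rw [h2, h1 bp (right_mem_Icc.2 h.lt.le)]

theorem jump_le (h : IsTraceOf n bm bp u V f T) :
    ∫⁻ x' : EuclideanSpace ℝ (Fin n),
        ‖boundaryRep T (withLast x' bp) - boundaryRep T (withLast x' bm)‖ₑ
      ≤ ∫⁻ x in strip n bm bp, ‖weakPartial u (Fin.last n) x‖ₑ := by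
  calc _ = ∫⁻ x', ‖traceAt bm V f bp x' - traceAt bm V f bm x'‖ₑ := by
        refine lintegral_congr_ae ?_
        filter_upwards [h.face_bottom, h.face_top] with x' h1 h2
        rw [h1, h2]
    _ ≤ _ := h.lintegral_jump_le
    _ = _ := by
        refine lintegral_congr_ae ?_
        filter_upwards [h.grad_apply_ae (Fin.last n)] with x hx
        rw [hx]

/-- The slab is the half of the collar that touches the face; its width `ε` is at least the length
of every admitted translation. -/
theorem faceModulus_le (h : IsTraceOf n bm bp u V f T) {ε : ℝ} (hε : 0 < ε) (hε' : ε < bp - bm)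
    {b : ℝ} (hb : b ∈ ({bm, bp} : Set ℝ)) :
    faceModulus (boundaryRep T) b ε ≤ 3 * ∫⁻ x in stripCollar n bm bp ε, ‖weakGradient u x‖ₑ := by
  obtain ⟨a, hJ, hba, hcol⟩ : ∃ a, Ioo a (a + ε) ⊆ Ioo bm bp ∧ b ∈ Icc a (a + ε) ∧
      Ioo a (a + ε) ⊆ Ioo bm (bm + ε) ∪ Ioo (bp - ε) bp := by
    rcases hb with rfl | rfl
    · exact ⟨b, Ioo_subset_Ioo le_rfl (by linarith), ⟨le_rfl, by linarith⟩, subset_union_left⟩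
    · refine ⟨b - ε, Ioo_subset_Ioo (by linarith) (by linarith), ⟨by linarith, by linarith⟩, ?_⟩
      rw [sub_add_cancel]
      exact subset_union_right
  refine iSup₂_le fun y hy => ?_
  calc _ = ∫⁻ x', ‖traceAt bm V f b (x' + y) - traceAt bm V f b x'‖ₑ := by
        refine lintegral_congr_ae ?_
        filter_upwards [h.face b hb,
          (measurePreserving_add_right volume y).quasiMeasurePreserving.ae (h.face b hb)]
          with x' h1 h2
        rw [h1, h2]
    _ ≤ 3 * ∫⁻ x in {x | x (Fin.last n) ∈ Ioo a (a + ε)}, ‖V x‖ₑ :=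
        h.lintegral_traceAt_translate_le (by linarith) hJ hba (by linarith)
    _ = 3 * ∫⁻ x in {x | x (Fin.last n) ∈ Ioo a (a + ε)}, ‖weakGradient u x‖ₑ := by
        congr 1
        refine lintegral_congr_ae ?_
        filter_upwards [ae_restrict_of_ae_restrict_of_subset (fun x hx => hJ hx) h.grad_ae]
          with x hx
        rw [hx]
    _ ≤ _ := by
        gcongr
        exact fun x hx => hcol hx

theorem faceModulus_tendsto (h : IsTraceOf n bm bp u V f T) {b : ℝ} (hb : b ∈ ({bm, bp} : Set ℝ)) :
    Tendsto (fun ε => faceModulus (boundaryRep T) b ε) (𝓝[>] 0) (𝓝 0) := by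
  have hi := integrableOn_weakGradient u
  have h1 := tendsto_lintegral_stripCollar h.lt hi.aestronglyMeasurable.enorm hi.2.ne
  have h2 := ENNReal.Tendsto.const_mul (a := 3) h1 (Or.inr (by simp))
  rw [mul_zero] at h2
  have h3 : ∀ᶠ ε in 𝓝[>] (0 : ℝ), ε < bp - bm :=
    nhdsWithin_le_nhds (Iio_mem_nhds (sub_pos.2 h.lt))
  refine tendsto_of_tendsto_of_tendsto_of_le_of_le' tendsto_const_nhds h2
    (Eventually.of_forall fun _ => zero_le) ?_
  filter_upwards [h3, self_mem_nhdsWithin] with ε h3 h4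
  exact h.faceModulus_le h4 h3 hb

/-- The normal is vertical: the last index produces the two face integrals with opposite signs, and
the other indices have no boundary term. -/
theorem integral_by_parts (h : IsTraceOf n bm bp u V f T)
    {ψ : EuclideanSpace ℝ (Fin (n + 1)) → ℝ} (hψ : ContDiff ℝ 1 ψ) (hc : HasCompactSupport ψ)
    (i : Fin (n + 1)) :
    ∫ x in strip n bm bp, sobolevRep u x * partialDeriv i ψ x
      = - (∫ x in strip n bm bp, ψ x * weakPartial u i x)
        + ∫ x, ψ x * boundaryRep T x * stripNormal bp i x ∂(surfaceMeasure (strip n bm bp)) := by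
  have hgrad : ∫ x in strip n bm bp, ψ x * V x i = ∫ x in strip n bm bp, ψ x * weakPartial u i x := by
    refine integral_congr_ae ?_
    filter_upwards [h.grad_apply_ae i] with x hx
    rw [hx]
  rw [← hgrad]
  induction i using Fin.lastCases with
  | last =>
    rw [h.integral_mul_partialDeriv_last hψ hc, integral_surfaceMeasure_strip h.lt
      (integrable_mul_boundaryRep_mul_stripNormal T hψ.continuous hc _)]
    have e1 : ∫ x', ψ (withLast x' bm) * boundaryRep T (withLast x' bm)
        * stripNormal bp (Fin.last n) (withLast x' bm)
        = - ∫ x', ψ (withLast x' bm) * traceAt bm V f bm x' := by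
      rw [← integral_neg]
      refine integral_congr_ae ?_
      filter_upwards [h.face_bottom] with x' hx
      rw [hx]
      simp [stripNormal, h.lt.ne]
    have e2 : ∫ x', ψ (withLast x' bp) * boundaryRep T (withLast x' bp)
        * stripNormal bp (Fin.last n) (withLast x' bp)
        = ∫ x', ψ (withLast x' bp) * traceAt bm V f bp x' := by
      refine integral_congr_ae ?_
      filter_upwards [h.face_top] with x' hx
      rw [hx]
      simp [stripNormal]
    rw [e1, e2]
    ring
  | cast j =>
    have hy : (EuclideanSpace.single j.castSucc (1 : ℝ) : EuclideanSpace ℝ (Fin (n + 1)))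
        (Fin.last n) = 0 := by
      rw [← withLast_single_zero]; simp
    have key := h.integral_mul_fderiv_horizontal hy hψ hc
    simp only [EuclideanSpace.inner_single_right] at key
    simp only [stripNormal, (Fin.castSucc_lt_last j).ne, if_false, mul_zero, integral_zero,
      add_zero]
    simpa [partialDeriv] using key

/-- The trace depends linearly on the function. -/
theorem smul_add (h : IsTraceOf n bm bp u V f T) {v : HomSobolev (strip n bm bp)}
    {V₁ V₂ : EuclideanSpace ℝ (Fin (n + 1)) → EuclideanSpace ℝ (Fin (n + 1))}
    {f₁ f₂ : EuclideanSpace ℝ (Fin n) → ℝ} {T₁ T₂ : LocL1Boundary (strip n bm bp)}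
    (h₁ : IsTraceOf n bm bp v V₁ f₁ T₁) {a : ℝ} (h₂ : IsTraceOf n bm bp (a • u + v) V₂ f₂ T₂) :
    T₂ = a • T + T₁ := by
  -- The data `V`, `f` are chosen separately for each function, so linearity is read off from
  -- integration by parts, which is linear in `u` and determines the trace.
  refine LocL1Boundary.ext_of_integral_eq fun ψ hψ hc => ?_
  set i := Fin.last n
  obtain ⟨C, hC⟩ := hc.exists_bound_of_continuous hψ.continuous
  have hdc := continuous_partialDeriv_of_contDiff_one i hψ
  have hds := hasCompactSupport_partialDeriv i hc
  have hψw : ∀ w : HomSobolev (strip n bm bp),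
      IntegrableOn (fun x => ψ x * weakPartial w i x) (strip n bm bp) := fun w =>
    (integrableOn_weakPartial w i).bdd_mul (c := C) hψ.continuous.aestronglyMeasurable
      (Eventually.of_forall hC)
  have e := h.integral_by_parts hψ hc i
  have e₁ := h₁.integral_by_parts hψ hc i
  have e₂ := h₂.integral_by_parts hψ hc i
  have r1 : ∫ x in strip n bm bp, sobolevRep (a • u + v) x * partialDeriv i ψ x
      = a * (∫ x in strip n bm bp, sobolevRep u x * partialDeriv i ψ x)
        + ∫ x in strip n bm bp, sobolevRep v x * partialDeriv i ψ x := by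
    rw [← integral_const_mul, ← integral_add ((h.integrableOn_mul hdc hds).const_mul a)
      (h₁.integrableOn_mul hdc hds)]
    refine integral_congr_ae ?_
    filter_upwards [sobolevRep_smul_add a u v] with x hx
    rw [hx]; ring
  have r2 : ∫ x in strip n bm bp, ψ x * weakPartial (a • u + v) i x
      = a * (∫ x in strip n bm bp, ψ x * weakPartial u i x)
        + ∫ x in strip n bm bp, ψ x * weakPartial v i x := by
    rw [← integral_const_mul, ← integral_add ((hψw u).const_mul a) (hψw v)]
    refine integral_congr_ae ?_
    filter_upwards [weakPartial_smul_add (isOpen_strip n bm bp) a u v i] with x hx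
    rw [hx]; ring
  have r3 : ∫ x, ψ x * boundaryRep (a • T + T₁) x * stripNormal bp i x
        ∂(surfaceMeasure (strip n bm bp))
      = a * (∫ x, ψ x * boundaryRep T x * stripNormal bp i x ∂(surfaceMeasure (strip n bm bp)))
        + ∫ x, ψ x * boundaryRep T₁ x * stripNormal bp i x ∂(surfaceMeasure (strip n bm bp)) := by
    rw [← integral_const_mul, ← integral_add
      ((integrable_mul_boundaryRep_mul_stripNormal T hψ.continuous hc i).const_mul a)
      (integrable_mul_boundaryRep_mul_stripNormal T₁ hψ.continuous hc i)]
    refine integral_congr_ae ?_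
    have h3 := AEEqFun.coeFn_add
      (a • (T : EuclideanSpace ℝ (Fin (n + 1)) →ₘ[surfaceMeasure (strip n bm bp)] ℝ)) T₁
    have h4 := AEEqFun.coeFn_smul a
      (T : EuclideanSpace ℝ (Fin (n + 1)) →ₘ[surfaceMeasure (strip n bm bp)] ℝ)
    filter_upwards [h3, h4] with x h3 h4
    simp only [boundaryRep, Submodule.coe_add, Submodule.coe_smul]
    rw [h3, Pi.add_apply, h4, Pi.smul_apply, smul_eq_mul]
    ring
  rw [r1, r2, e, e₁] at e₂
  rw [r3]
  linarith

end IsTraceOf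

/-! ### The trace operator and its uniqueness -/

theorem exists_stripTrace {n : ℕ} {bm bp : ℝ} (hb : bm < bp) :
    ∃ Tr : HomSobolev (strip n bm bp) →ₗ[ℝ] LocL1Boundary (strip n bm bp),
      ∀ u, ∃ V f, IsTraceOf n bm bp u V f (Tr u) := by
  choose T V f hT using exists_isTraceOf (n := n) hb
  have hlin : ∀ (a : ℝ) u v, T (a • u + v) = a • T u + T v := fun a u v =>
    (hT u).smul_add (hT v) (hT _)
  -- The instance reads `T 0 = T 0 + T 0`.
  have h0 : T 0 = 0 := by simpa using hlin 1 0 0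
  exact ⟨{ toFun := T
           map_add' := fun u v => by simpa using hlin 1 u v
           map_smul' := fun a u => by simpa [h0] using hlin a u 0 }, fun u => ⟨_, _, hT u⟩⟩

end

theorem theorem1p4 (n : ℕ) (hn : 1 ≤ n) :
    ∃ c : ℝ, 0 < c ∧ ∀ bm bp : ℝ, bm < bp →
      ∃ Tr : HomSobolev (strip n bm bp) →ₗ[ℝ] LocL1Boundary (strip n bm bp),
        IsStripTrace n bm bp c Tr ∧
        ∀ (c' : ℝ) (Tr' : HomSobolev (strip n bm bp) →ₗ[ℝ] LocL1Boundary (strip n bm bp)),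
          IsStripTrace n bm bp c' Tr' → Tr' = Tr := by
  -- The constant of `lintegral_traceAt_translate_le`, the same in every dimension.
  refine ⟨3, by norm_num, fun bm bp hb => ?_⟩
  obtain ⟨Tr, hTr⟩ := exists_stripTrace (n := n) hb
  choose V f h using hTr
  refine ⟨Tr, ?_, fun c' Tr' h' => LinearMap.ext fun u => ?_⟩
  · exact
      { eq_of_continuous := fun u v hv huv => (h u).ae_eq_of_continuousOn hv huv
        jump_le := fun u => (h u).jump_le
        modulus_le := fun u ε hε hε' b hbb => by
          simpa using (h u).faceModulus_le hε hε' hbb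
        modulus_tendsto := fun u b hbb => (h u).faceModulus_tendsto hbb
        integrableOn_mul := fun u ψ hψ hc i =>
          (h u).integrableOn_mul (continuous_partialDeriv_of_contDiff_one i hψ)
            (hasCompactSupport_partialDeriv i hc)
        integral_by_parts := fun u ψ hψ hc i => (h u).integral_by_parts hψ hc i }
  -- Only integration by parts in the last direction is used, so `c'` plays no role.
  · refine LocL1Boundary.ext_of_integral_eq fun ψ hψ hc => ?_
    have e1 := h'.integral_by_parts u ψ hψ hc (Fin.last n)
    have e2 := (h u).integral_by_parts hψ hc (Fin.last n)
    linarith
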